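/- Let $a,b,c>0$ be pairwise distinct. Let $G_1$ and $G_2$ be the quantum graph analogs of the $7_1$ pair of isospectral planar domains of Buser, Conway, Doyle and Semmler: take seven 3-stars, numbered $0,\dots,6$, each consisting of a central vertex and three edges, labelled $a,b,c$ and of lengths $a,b,c$ respectively; whenever stars $i$ and $j$ are said to be glued along a label, the outer ends of their edges with this label are identified to one vertex of degree two. For $G_1$ the gluings are $\{0,3\},\{5,6\}$ along $a$, $\{0,5\},\{1,2\}$ along $b$, and $\{0,1\},\{3,4\}$ along $c$; for $G_2$ they are $\{0,3\},\{5,6\}$ along $a$, $\{0,1\},\{3,4\}$ along $b$, and $\{0,5\},\{1,2\}$ along $c$. For a finite metric graph $G$ let $\Delta$ be the second derivative along the edges, acting in $L^2(G)=\bigoplus_e L^2([0,l_e])$, with Dirichlet standard boundary conditions: its domain consists of the functions $\phi$, continuous on $G$, such that on every edge $\phi$ and $\phi'$ are absolutely continuous and $\phi''\in L^2$, that $\phi(v)=0$ at every vertex $v$ of degree one, and that at every other vertex the derivatives along the incident edges, directed into the vertex, add up to zero. If $(\phi_n)_{n\ge 0}$ is an orthonormal basis of $L^2(G)$ of eigenfunctions,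 $-\Delta\phi_n=\lambda_n\phi_n$, then the heat kernel and the heat content of $G$ are $$p_G(t,x,y)=\sum_n e^{-\lambda_n t}\phi_n(x)\overline{\phi_n(y)},\qquad q_G(t)=\int_G\int_G p_G(t,x,y)\,dx\,dy\qquad(t>0).$$ Then $G_1$ and $G_2$ are isospectral (every number is an eigenvalue of the two Laplacians with the same multiplicity), both have an orthonormal basis of eigenfunctions as above, and their heat contents are different: for any choice of such bases there is $t>0$ with $q_{G_1}(t)\neq q_{G_2}(t)$. -/

import Mathlib

open MeasureTheory Set
open scoped ComplexConjugate

noncomputable section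

/-- A finite metric graph with vertex set `V` and edge set `E`, with a choice of orientation: the
edge `e` is identified with the interval `[0, len e]`, where `0` is the vertex `src e` and `len e`
is the vertex `tgt e`. There are no loops. -/
structure MetricGraph (V E : Type) where
  src : E → V
  tgt : E → V
  src_ne_tgt : ∀ e, src e ≠ tgt e
  len : E → ℝ
  len_pos : ∀ e, 0 < len e

namespace MetricGraph

variable {V E : Type}

/-- Lebesgue measure on the edge `[0, len e]`. -/
abbrev edgeMeasure (G : MetricGraph V E) (e : E) : Measure ℝ :=
  volume.restrict (Icc 0 (G.len e))

/-- The Hilbert space `⊕ₑ L²([0, len e])` of a metric graph. -/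
abbrev L2 (G : MetricGraph V E) : Type :=
  PiLp 2 fun e : E => Lp ℂ 2 (G.edgeMeasure e)

theorem integral_congr_edge (G : MetricGraph V E) {e : E} {x : ℝ} (hx : x ∈ Icc 0 (G.len e))
    {u w : ℝ → ℂ} (h : u =ᵐ[G.edgeMeasure e] w) :
    ∫ s in (0 : ℝ)..x, u s = ∫ s in (0 : ℝ)..x, w s := by
  rw [intervalIntegral.integral_of_le hx.1, intervalIntegral.integral_of_le hx.1]
  exact integral_congr_ae (ae_restrict_of_ae_restrict_of_subset
    (Ioc_subset_Icc_self.trans (Icc_subset_Icc_right hx.2)) h)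

theorem intervalIntegrable_edge {G : MetricGraph V E} {e : E} {x : ℝ}
    (hx : x ∈ Icc 0 (G.len e)) {u : ℝ → ℂ} (h : IntegrableOn u (Icc 0 (G.len e))) :
    IntervalIntegrable u volume 0 x := by
  rw [intervalIntegrable_iff_integrableOn_Icc_of_le hx.1]
  exact h.mono_set (Icc_subset_Icc_right hx.2)

/-- The representative `dφ` in the definition of `Δ` is continuous on the edge. -/
theorem continuousOn_of_primitive (G : MetricGraph V E) (g : G.L2) (e : E) (ψ : ℝ → ℂ)
    (h : ∀ x ∈ Icc 0 (G.len e), ψ x = ψ 0 + ∫ s in (0 : ℝ)..x, g e s) :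
    IntegrableOn (g e) (Icc 0 (G.len e)) ∧ ContinuousOn ψ (Icc 0 (G.len e)) := by
  have hg : IntegrableOn (g e) (Icc 0 (G.len e)) :=
    (Lp.memLp (g e)).integrable (by norm_num)
  refine ⟨hg, ContinuousOn.congr ?_ h⟩
  exact continuousOn_const.add (intervalIntegral.continuousOn_primitive_interval'
    (by rw [intervalIntegrable_iff_integrableOn_Icc_of_le (G.len_pos e).le]; exact hg)
    (by simp) |>.mono (by rw [uIcc_of_le (G.len_pos e).le]))

variable [DecidableEq V] [Fintype E]

/-- The number of edges on which the vertex `v` is incident. -/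
def degree (G : MetricGraph V E) (v : V) : ℕ :=
  (Finset.univ.filter fun e : E => G.src e = v ∨ G.tgt e = v).card

/-- `φ` satisfies Dirichlet standard boundary conditions, where `dφ` is the derivative of `φ` in
the coordinates of the edges: `φ` is continuous at every vertex, it vanishes at every vertex of
degree one, and at every other vertex the derivatives along the incident edges, directed into the
vertex, add up to zero. -/
structure DirichletStandard (G : MetricGraph V E) (φ dφ : E → ℝ → ℂ) : Prop where
  continuous_and_dirichlet : ∃ val : V → ℂ,
    (∀ e, φ e 0 = val (G.src e) ∧ φ e (G.len e) = val (G.tgt e)) ∧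
    ∀ v, G.degree v = 1 → val v = 0
  kirchhoff : ∀ v, G.degree v ≠ 1 →
    (∑ e with G.tgt e = v, dφ e (G.len e)) + (∑ e with G.src e = v, -dφ e 0) = 0

/-- The Laplacian with Dirichlet standard boundary conditions, given by its graph: `f` lies in the
domain of `Δ` and `Δ f = g`. On every edge, `f` has a representative `φ` such that `φ` and its
derivative `dφ` are absolutely continuous on `[0, len e]` (i.e. each is the integral of its
derivative), the second derivative is `g`, which is square integrable, and the boundary conditions
hold. -/
def IsLaplacian (G : MetricGraph V E) (f g : G.L2) : Prop :=
  ∃ φ dφ : E → ℝ → ℂ,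
    (∀ e, f e =ᵐ[G.edgeMeasure e] φ e) ∧
    (∀ e, ∀ x ∈ Icc 0 (G.len e), φ e x = φ e 0 + ∫ s in (0 : ℝ)..x, dφ e s) ∧
    (∀ e, ∀ x ∈ Icc 0 (G.len e), dφ e x = dφ e 0 + ∫ s in (0 : ℝ)..x, g e s) ∧
    G.DirichletStandard φ dφ

theorem isLaplacian_zero (G : MetricGraph V E) : G.IsLaplacian 0 0 := by
  refine ⟨0, 0, fun e => ?_, fun e x _ => by simp, fun e x hx => ?_, ⟨0, by simp, by simp⟩, by simp⟩
  · exact Lp.coeFn_zero ℂ 2 (G.edgeMeasure e)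
  · have h0 : ∀ᵐ s ∂(G.edgeMeasure e), (0 : Lp ℂ 2 (G.edgeMeasure e)) s = 0 :=
      Lp.coeFn_zero ℂ 2 (G.edgeMeasure e)
    have : ∫ s in (0 : ℝ)..x, (0 : Lp ℂ 2 (G.edgeMeasure e)) s = 0 := by
      rw [intervalIntegral.integral_of_le hx.1]
      refine integral_eq_zero_of_ae ?_
      exact ae_restrict_of_ae_restrict_of_subset
        (Ioc_subset_Icc_self.trans (Icc_subset_Icc_right hx.2)) h0
    simpa using this.symm

theorem IsLaplacian.add {G : MetricGraph V E} {f g f' g' : G.L2}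
    (h : G.IsLaplacian f g) (h' : G.IsLaplacian f' g') : G.IsLaplacian (f + f') (g + g') := by
  obtain ⟨φ, dφ, h1, h2, h3, ⟨val, hv, hd⟩, hk⟩ := h
  obtain ⟨φ', dφ', h1', h2', h3', ⟨val', hv', hd'⟩, hk'⟩ := h'
  refine ⟨fun e x => φ e x + φ' e x, fun e x => dφ e x + dφ' e x, fun e => ?_, fun e x hx => ?_,
    fun e x hx => ?_, ⟨val + val', fun e => ⟨?_, ?_⟩, fun v hdeg => ?_⟩, fun v hdeg => ?_⟩
  · filter_upwards [Lp.coeFn_add (f e) (f' e), h1 e, h1' e] with x hx ha hb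
    rw [PiLp.add_apply, hx, Pi.add_apply, ha, hb]
  · have c := (G.continuousOn_of_primitive g e _ (h3 e)).2.integrableOn_Icc (μ := volume)
    have c' := (G.continuousOn_of_primitive g' e _ (h3' e)).2.integrableOn_Icc (μ := volume)
    rw [intervalIntegral.integral_add (intervalIntegrable_edge hx c)
      (intervalIntegrable_edge hx c')]
    beta_reduce
    rw [h2 e x hx, h2' e x hx]
    ring
  · have c := (G.continuousOn_of_primitive g e _ (h3 e)).1
    have c' := (G.continuousOn_of_primitive g' e _ (h3' e)).1
    rw [PiLp.add_apply, G.integral_congr_edge hx (Lp.coeFn_add (g e) (g' e))]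
    simp only [Pi.add_apply]
    rw [intervalIntegral.integral_add (intervalIntegrable_edge hx c)
      (intervalIntegrable_edge hx c'), h3 e x hx, h3' e x hx]
    ring
  · simp [(hv e).1, (hv' e).1]
  · simp [(hv e).2, (hv' e).2]
  · simp [hd v hdeg, hd' v hdeg]
  · have a := hk v hdeg
    have b := hk' v hdeg
    simp only [Finset.sum_add_distrib, Finset.sum_neg_distrib] at a b ⊢
    linear_combination a + b

theorem IsLaplacian.smul {G : MetricGraph V E} {f g : G.L2} (c : ℂ)
    (h : G.IsLaplacian f g) : G.IsLaplacian (c • f) (c • g) := by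
  obtain ⟨φ, dφ, h1, h2, h3, ⟨val, hv, hd⟩, hk⟩ := h
  refine ⟨fun e x => c * φ e x, fun e x => c * dφ e x, fun e => ?_, fun e x hx => ?_,
    fun e x hx => ?_, ⟨c • val, fun e => ⟨?_, ?_⟩, fun v hdeg => ?_⟩, fun v hdeg => ?_⟩
  · filter_upwards [Lp.coeFn_smul c (f e), h1 e] with x hx ha
    rw [PiLp.smul_apply, hx, Pi.smul_apply, ha, smul_eq_mul]
  · simp only [intervalIntegral.integral_const_mul]
    rw [h2 e x hx]
    ring
  · rw [PiLp.smul_apply, G.integral_congr_edge hx (Lp.coeFn_smul c (g e))]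
    simp only [Pi.smul_apply, smul_eq_mul, intervalIntegral.integral_const_mul]
    rw [h3 e x hx]
    ring
  · simp [(hv e).1]
  · simp [(hv e).2]
  · simp [hd v hdeg]
  · have a := hk v hdeg
    simp only [Finset.sum_neg_distrib, ← Finset.mul_sum] at a ⊢
    linear_combination c * a

/-- The space of solutions `f` of `-Δ f = μ f` in the domain of `Δ`. -/
def eigenspace (G : MetricGraph V E) (μ : ℂ) : Submodule ℂ G.L2 where
  carrier := {f | G.IsLaplacian f (-(μ • f))}
  zero_mem' := by simpa using G.isLaplacian_zero
  add_mem' {f g} hf hg := by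
    have h := IsLaplacian.add hf hg
    simpa only [mem_ofPred_eq, smul_add, neg_add] using h
  smul_mem' c f hf := by
    have h := IsLaplacian.smul c hf
    simpa only [mem_ofPred_eq, smul_neg, smul_comm c μ f] using h

/-- Two quantum graphs are isospectral if they have the same eigenvalues with the same
multiplicities. -/
def Isospectral {V' E' : Type} [DecidableEq V'] [Fintype E']
    (G : MetricGraph V E) (G' : MetricGraph V' E') : Prop :=
  ∀ μ : ℂ, Module.rank ℂ (G.eigenspace μ) = Module.rank ℂ (G'.eigenspace μ)

/-- A complete orthonormal system of eigenfunctions `φ₀, φ₁, …` of `-Δ`, with the eigenvalues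
`λ₀, λ₁, …`, repeated according to multiplicity. -/
structure SpectralResolution (G : MetricGraph V E) where
  basis : HilbertBasis ℕ ℂ G.L2
  eigenvalue : ℕ → ℝ
  isLaplacian : ∀ n, basis n ∈ G.eigenspace (eigenvalue n)

namespace SpectralResolution

variable {G : MetricGraph V E}

/-- The heat kernel `p(t, x, y) = ∑ₙ exp (-λₙ t) φₙ(x) conj φₙ(y)` at the point with
coordinate `x` on the edge `e` and the point with coordinate `y` on the edge `e'`. -/
def heatKernel (S : G.SpectralResolution) (t : ℝ) (e : E) (x : ℝ) (e' : E) (y : ℝ) : ℂ :=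
  ∑' n, (Real.exp (-S.eigenvalue n * t) : ℂ) * S.basis n e x * conj (S.basis n e' y)

/-- The heat content `q(t) = ∫∫ p(t, x, y) dx dy`. -/
def heatContent (S : G.SpectralResolution) (t : ℝ) : ℂ :=
  ∑ e, ∫ x in Icc 0 (G.len e), ∑ e', ∫ y in Icc 0 (G.len e'), S.heatKernel t e x e' y

end SpectralResolution

end MetricGraph

/-- Instructions for gluing seven triangles, with sides labelled by `Fin 3`, along equally labelled
sides: the triangles `i` and `glue k i` share the side labelled `k`, and this side is a boundary
side of `i` if `glue k i = i`. -/
structure Gluing where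
  glue : Fin 3 → Equiv.Perm (Fin 7)
  involutive : ∀ k i, glue k (glue k i) = i

namespace Gluing

/-- Outer ends of the edges of the 3-stars after gluing: the edges labelled `k` of the stars `i` and
`glue k i` have the same outer end, represented by the smaller one of the two stars. -/
abbrev OuterVertex (σ : Gluing) : Type :=
  {p : Fin 7 × Fin 3 // p.1 ≤ σ.glue p.2 p.1}

/-- The metric graph analog of a glued family of triangles: every triangle `i` is replaced by a
3-star, with a central vertex `Sum.inl i` and three edges `(i, k)` of length `l k`, and edges which
belong to a common side of two triangles are joined at a common vertex of degree two. -/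
def starGraph (σ : Gluing) (l : Fin 3 → ℝ) (hl : ∀ k, 0 < l k) :
    MetricGraph (Fin 7 ⊕ σ.OuterVertex) (Fin 7 × Fin 3) where
  src e := Sum.inl e.1
  tgt e := Sum.inr ⟨(min e.1 (σ.glue e.2 e.1), e.2), by
    rcases le_total e.1 (σ.glue e.2 e.1) with h | h
    · simpa [min_eq_left h] using h
    · simpa [min_eq_right h, σ.involutive e.2 e.1] using h⟩
  src_ne_tgt e := by simp
  len e := l e.2
  len_pos e := hl e.2

/-- The first domain of the `7₁` pair: sides `a, b, c` are labelled `0, 1, 2`; triangle `0` is glued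
to `3, 5, 1` along `a, b, c`, and further `5, 6` along `a`, `1, 2` along `b` and `3, 4`
along `c`. -/
def sevenOneFirst : Gluing where
  glue := ![Equiv.swap 0 3 * Equiv.swap 5 6, Equiv.swap 0 5 * Equiv.swap 1 2,
    Equiv.swap 0 1 * Equiv.swap 3 4]
  involutive := by decide

/-- The second domain of the `7₁` pair: triangle `0` is glued to `3, 1, 5` along `a, b, c`, and
further `5, 6` along `a`, `3, 4` along `b` and `1, 2` along `c`. -/
def sevenOneSecond : Gluing where
  glue := ![Equiv.swap 0 3 * Equiv.swap 5 6, Equiv.swap 0 1 * Equiv.swap 3 4,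
    Equiv.swap 0 5 * Equiv.swap 1 2]
  involutive := by decide

end Gluing

end

/-! The invariant that separates the two graphs is the time integral of the heat content.
Integrating the spectral series over t > 0 gives ∑ |⟨1, φ_n⟩|² / λ_n = -⟨1, Δ⁻¹ 1⟩, the torsional
rigidity (`integral_heatContent`). If the heat contents agreed for all t > 0, so would the
rigidities.

The rigidity is computable. The solution of Δu = 1 is a quadratic polynomial on every edge, so it is
determined by its values at the seven star centers, and the vertex conditions become a 7 × 7 linear
system (`exists_torsion_equations`). The stars form a tree: star 0 in the middle with the three
branches 3–4, 5–6 and 1–2. Cramer's rule, in the inverse lengths p, q, r, yields a determinant and a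
numerator (`torsionDet_mul_eq`). The second gluing is the first with the labels b and c exchanged,
which is the substitution q ↔ r. It preserves the determinant, but changes the numerator by (p -
q)(q - r)(r - p) times a polynomial with positive coefficients (`torsionNum_sub_swap`).

Isospectrality is transplantation. The conditions at the outer ends say that the seven-component
function on the edges with one label is fixed by a signed permutation, up to a sign for the
derivatives. An invertible integer matrix that intertwines these signed permutations for all three
labels carries eigenfunctions of one graph to eigenfunctions of the other (`isLaplacian_transplant`,
`rank_eigenspace_le`).

The analysis rests on one estimate: if every component has a Dirichlet vertex, then sup |f|² ≤ C
‖Δf‖² (`Anchored.exists_bound`). It makes Δ⁻¹ Hilbert–Schmidt, hence compact, which gives the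
eigenbasis. It also gives ∑ λ_n⁻² < ∞ and |φ_n| ≤ D λ_n almost everywhere, which justify all
interchanges of sums and integrals. -/

open MeasureTheory Set
open scoped ComplexConjugate

noncomputable section

/-! ### Primitives of integrable functions on an interval -/

section Interval

variable {l : ℝ} {u w φ ψ : ℝ → ℂ}

/-- Interchange of the order of integration over the triangle `0 < s ≤ x ≤ l`. -/
theorem integral_primitive_mul_eq (hl : 0 ≤ l) (hu : IntervalIntegrable u volume 0 l)
    (hw : IntervalIntegrable w volume 0 l) :
    ∫ x in (0 : ℝ)..l, (∫ s in (0 : ℝ)..x, u s) * w x =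
      ∫ s in (0 : ℝ)..l, u s * ∫ x in s..l, w x := by
  have hu' : IntegrableOn u (Ioc 0 l) := (intervalIntegrable_iff_integrableOn_Ioc_of_le hl).1 hu
  have hw' : IntegrableOn w (Ioc 0 l) := (intervalIntegrable_iff_integrableOn_Ioc_of_le hl).1 hw
  -- Both sides are iterated integrals of w(x) u(s) cut off to the triangle s ≤ x, so Fubini applies
  -- on the square.
  let F : ℝ → ℝ → ℂ := fun x s => {p : ℝ × ℝ | p.2 ≤ p.1}.indicator (fun p => w p.1 * u p.2) (x, s)
  have hF : IntegrableOn F.uncurry (uIoc 0 l ×ˢ uIoc 0 l) := by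
    rw [uIoc_of_le hl, IntegrableOn, Measure.volume_eq_prod, ← Measure.prod_restrict]
    exact (hw'.mul_prod hu').indicator (measurableSet_le measurable_snd measurable_fst)
  have key := intervalIntegral_intervalIntegral_swap hF
  rw [intervalIntegral.integral_of_le hl, intervalIntegral.integral_of_le hl] at key ⊢
  convert key using 1
  · refine setIntegral_congr_fun measurableSet_Ioc fun x hx => ?_
    simp only [F]
    rw [intervalIntegral.integral_of_le hx.1.le, intervalIntegral.integral_of_le hl, mul_comm,
      ← integral_const_mul, 
      show Ioc 0 x = Ioc 0 l ∩ Iic x by grind, ← setIntegral_indicator measurableSet_Iic]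
    exact integral_congr_ae (.of_forall fun s => by simp [indicator_apply])
  · refine setIntegral_congr_fun measurableSet_Ioc fun s hs => ?_
    simp only [F]
    rw [intervalIntegral.integral_of_le hs.2, intervalIntegral.integral_of_le hl,
      ← integral_const_mul, ← integral_Icc_eq_integral_Ioc, show Icc s l = Ioc 0 l ∩ Ici s by grind,
      ← setIntegral_indicator measurableSet_Ici]
    exact integral_congr_ae (.of_forall fun x => by simp [indicator_apply, mul_comm])

/-- Integration by parts for primitives of integrable functions. -/
theorem integral_mul_of_primitive (hl : 0 ≤ l) (hu : IntervalIntegrable u volume 0 l)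
    (hw : IntervalIntegrable w volume 0 l)
    (hφ : ∀ x ∈ Icc 0 l, φ x = φ 0 + ∫ s in (0 : ℝ)..x, u s)
    (hψ : ∀ x ∈ Icc 0 l, ψ x = ψ 0 + ∫ s in (0 : ℝ)..x, w s) :
    ∫ x in (0 : ℝ)..l, φ x * w x = φ l * ψ l - φ 0 * ψ 0 - ∫ x in (0 : ℝ)..l, u x * ψ x := by
  have cu : ContinuousOn (fun x => ∫ s in (0 : ℝ)..x, u s) (uIcc 0 l) :=
    intervalIntegral.continuousOn_primitive_interval' hu (by simp)
  have cw : ContinuousOn (fun s => ∫ x in s..l, w x) (uIcc 0 l) := by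
    have := (intervalIntegral.continuousOn_primitive_interval' hw.symm
      (by rw [uIcc_comm]; simp : l ∈ uIcc l 0)).neg
    rw [uIcc_comm]
    refine this.congr fun s _ => ?_
    rw [intervalIntegral.integral_symm, Pi.neg_apply]
  have e1 : ∫ x in (0 : ℝ)..l, φ x * w x =
      φ 0 * (∫ x in (0 : ℝ)..l, w x) + ∫ x in (0 : ℝ)..l, (∫ s in (0 : ℝ)..x, u s) * w x := by
    rw [← intervalIntegral.integral_const_mul, ← intervalIntegral.integral_add
      (hw.const_mul _) (hw.continuousOn_mul cu)]
    refine intervalIntegral.integral_congr fun x hx => ?_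
    rw [uIcc_of_le hl] at hx
    simp only [hφ x hx]
    ring
  have e2 : ∫ x in (0 : ℝ)..l, u x * ψ x =
      (∫ x in (0 : ℝ)..l, u x) * ψ l - ∫ s in (0 : ℝ)..l, u s * ∫ x in s..l, w x := by
    rw [← intervalIntegral.integral_mul_const, ← intervalIntegral.integral_sub
      (hu.mul_const _) (hu.mul_continuousOn cw)]
    refine intervalIntegral.integral_congr fun x hx => ?_
    have hx' := hx
    rw [uIcc_of_le hl] at hx'
    have := intervalIntegral.integral_add_adjacent_intervals
      (hw.mono_set (uIcc_subset_uIcc (by simp) hx) : IntervalIntegrable w volume 0 x)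
      (hw.mono_set (uIcc_subset_uIcc hx (by simp)) : IntervalIntegrable w volume x l)
    rw [hψ x hx', hψ l (right_mem_Icc.2 hl), ← this]
    ring
  have hl' := right_mem_Icc.2 hl
  rw [e1, e2, integral_primitive_mul_eq hl hu hw, hψ l hl', hφ l hl']
  ring

/-- A function on an interval is determined by its primitive. -/
theorem ae_eq_zero_of_primitive_eq_zero (hl : 0 < l) (hu : IntegrableOn u (Icc 0 l))
    (h : ∀ x ∈ Icc 0 l, ∫ s in (0 : ℝ)..x, u s = 0) : u =ᵐ[volume.restrict (Icc 0 l)] 0 := by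
  have hu' : IntervalIntegrable u volume 0 l :=
    (intervalIntegrable_iff_integrableOn_Icc_of_le hl.le).2 hu
  rw [← restrict_Ioo_eq_restrict_Icc, Filter.EventuallyEq, ae_restrict_iff' measurableSet_Ioo]
  filter_upwards [hu'.ae_hasDerivAt_integral] with x hx hxl
  have hd := hx (by rw [uIcc_of_le hl.le]; exact Ioo_subset_Icc_self hxl) 0 (by simp)
  refine hd.unique ((hasDerivAt_const x (0 : ℂ)).congr_of_eventuallyEq ?_)
  filter_upwards [Ioo_mem_nhds hxl.1 hxl.2] with y hy using h y (Ioo_subset_Icc_self hy)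

/-- The Cauchy–Schwarz inequality for a primitive. -/
theorem norm_integral_sq_le (hu : ContinuousOn u (Icc 0 l)) {x : ℝ}
    (hx : x ∈ Icc 0 l) :
    ‖∫ s in (0 : ℝ)..x, u s‖ ^ 2 ≤ l * ∫ s in Icc 0 l, ‖u s‖ ^ 2 := by
  have hl : 0 ≤ l := hx.1.trans hx.2
  have i1 : IntegrableOn (fun s => ‖u s‖) (Icc 0 l) := hu.norm.integrableOn_Icc
  have i2 : IntegrableOn (fun s => ‖u s‖ ^ 2) (Icc 0 l) := (hu.norm.pow 2).integrableOn_Icc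
  set I := ∫ s in Icc 0 l, ‖u s‖ with hI
  set J := ∫ s in Icc 0 l, ‖u s‖ ^ 2 with hJ
  have h1 : ‖∫ s in (0 : ℝ)..x, u s‖ ≤ I := by
    rw [intervalIntegral.integral_of_le hx.1, ← integral_Icc_eq_integral_Ioc]
    refine (norm_integral_le_integral_norm _).trans ?_
    exact setIntegral_mono_set i1 (.of_forall fun s => norm_nonneg _)
      (Icc_subset_Icc_right hx.2).eventuallyLE
  have h2 : ∀ c : ℝ, 0 ≤ J - 2 * c * I + c ^ 2 * l := fun c => by
    have : ∫ s in Icc 0 l, (‖u s‖ - c) ^ 2 = J - 2 * c * I + c ^ 2 * l := by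
      have e : ∀ s, (‖u s‖ - c) ^ 2 = ‖u s‖ ^ 2 - 2 * c * ‖u s‖ + c ^ 2 := fun s => by ring
      simp_rw [e]
      have i3 : IntegrableOn (fun _ : ℝ => c ^ 2) (Icc 0 l) := by simp
      have i4 := i1.const_mul (2 * c)
      have i5 : IntegrableOn (fun s => ‖u s‖ ^ 2 - 2 * c * ‖u s‖) (Icc 0 l) := i2.sub i4
      rw [integral_add i5 i3, integral_sub i2 i4, integral_const_mul]
      simp [hl, mul_comm, I, J]
    rw [← this]
    exact integral_nonneg fun s => sq_nonneg _
  have h3 : 0 ≤ I := integral_nonneg fun s => norm_nonneg _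
  refine (pow_le_pow_left₀ (norm_nonneg _) h1 2).trans ?_
  rcases hl.eq_or_lt with rfl | hl
  · have : I = 0 := by simp [hI]
    simp [this]
  -- The mean I / l minimises the quadratic in c; its minimum is J - I² / l.
  · have := h2 (I / l)
    have e : J - 2 * (I / l) * I + (I / l) ^ 2 * l = (l * J - I ^ 2) / l := by field_simp; ring
    rw [e] at this
    rw [le_div_iff₀ hl] at this
    linarith

end Interval

/-! ### Green's identity and the a priori estimate on a metric graph -/

namespace MetricGraph

variable {V E : Type} {G : MetricGraph V E}

theorem integrableOn_edge (g : G.L2) (e : E) : IntegrableOn (g e) (Icc 0 (G.len e)) :=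
  (Lp.memLp (g e)).integrable (by norm_num)

theorem right_mem_edge (G : MetricGraph V E) (e : E) : G.len e ∈ Icc 0 (G.len e) :=
  right_mem_Icc.2 (G.len_pos e).le

theorem memLp_of_continuousOn_edge {φ : E → ℝ → ℂ} (e : E)
    (h : ContinuousOn (φ e) (Icc 0 (G.len e))) : MemLp (φ e) 2 (G.edgeMeasure e) := by
  obtain ⟨C, hC⟩ := isCompact_Icc.exists_bound_of_continuousOn h
  refine MemLp.of_bound (h.aestronglyMeasurable measurableSet_Icc) C ?_
  filter_upwards [ae_restrict_mem measurableSet_Icc] with x hx using hC x hx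

variable [Fintype E]

theorem inner_eq_sum_integral {f' : G.L2} {φ' : E → ℝ → ℂ} (h : ∀ e, f' e =ᵐ[G.edgeMeasure e] φ' e) (g : G.L2) :
    inner ℂ f' g = ∑ e, ∫ x in (0 : ℝ)..G.len e, conj (φ' e x) * g e x := by
  rw [PiLp.inner_apply]
  refine Finset.sum_congr rfl fun e _ => ?_
  rw [L2.inner_def, intervalIntegral.integral_of_le (G.len_pos e).le,
    ← integral_Icc_eq_integral_Ioc]
  refine integral_congr_ae ?_
  filter_upwards [h e] with x hx
  rw [RCLike.inner_apply, hx, mul_comm]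

/-- The Dirichlet energy. -/
def energy (G : MetricGraph V E) (dφ : E → ℝ → ℂ) : ℝ :=
  ∑ e, ∫ x in Icc 0 (G.len e), ‖dφ e x‖ ^ 2

theorem integral_le_energy (G : MetricGraph V E) (dφ : E → ℝ → ℂ) (e : E) :
    ∫ x in Icc 0 (G.len e), ‖dφ e x‖ ^ 2 ≤ G.energy dφ :=
  Finset.single_le_sum (f := fun e => ∫ x in Icc 0 (G.len e), ‖dφ e x‖ ^ 2)
    (fun _ _ => integral_nonneg fun _ => sq_nonneg _) (Finset.mem_univ e)

theorem energy_nonneg (G : MetricGraph V E) (dφ : E → ℝ → ℂ) : 0 ≤ G.energy dφ :=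
  Finset.sum_nonneg fun _ _ => integral_nonneg fun _ => sq_nonneg _

theorem norm_sq_eq (f : G.L2) : ‖f‖ ^ 2 = ∑ e, ∫ x in Icc 0 (G.len e), ‖f e x‖ ^ 2 := by
  rw [PiLp.norm_sq_eq_of_L2]
  refine Finset.sum_congr rfl fun e _ => ?_
  have h := L2.inner_def (𝕜 := ℂ) (f e) (f e)
  have e1 : ∀ x, inner ℂ (f e x) (f e x) = ((‖f e x‖ ^ 2 : ℝ) : ℂ) := fun x => by
    rw [inner_self_eq_norm_sq_to_K]; simp
  rw [inner_self_eq_norm_sq_to_K] at h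
  simp_rw [e1] at h
  rw [integral_complex_ofReal] at h
  exact Complex.ofReal_injective (by rw [← h]; simp)

theorem norm_sq_le_of_ae_le {f : G.L2} {M : ℝ}
    (h : ∀ e, ∀ᵐ x ∂G.edgeMeasure e, ‖f e x‖ ^ 2 ≤ M) : ‖f‖ ^ 2 ≤ (∑ e, G.len e) * M := by
  rw [norm_sq_eq, Finset.sum_mul]
  refine Finset.sum_le_sum fun e _ => ?_
  have : ∫ _ in Icc 0 (G.len e), M = G.len e * M := by simp [(G.len_pos e).le]
  rw [← this]
  have hf := (Lp.memLp (f e)).integrable_norm_pow (p := 2) (by norm_num)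
  exact integral_mono_ae hf (integrable_const M) (h e)

variable [DecidableEq V]

/-- `φ` is a representative of `f` with derivative `dφ`, exhibiting that `f` lies in the domain of
`Δ` and that `Δ f = g`. -/
structure IsRep (G : MetricGraph V E) (f g : G.L2) (φ dφ : E → ℝ → ℂ) : Prop where
  ae_eq : ∀ e, f e =ᵐ[G.edgeMeasure e] φ e
  primitive : ∀ e, ∀ x ∈ Icc 0 (G.len e), φ e x = φ e 0 + ∫ s in (0 : ℝ)..x, dφ e s
  deriv_primitive : ∀ e, ∀ x ∈ Icc 0 (G.len e), dφ e x = dφ e 0 + ∫ s in (0 : ℝ)..x, g e s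
  boundary : G.DirichletStandard φ dφ

theorem isLaplacian_iff_exists_isRep {G : MetricGraph V E} {f g : G.L2} :
    G.IsLaplacian f g ↔ ∃ φ dφ, G.IsRep f g φ dφ :=
  ⟨fun ⟨φ, dφ, h1, h2, h3, h4⟩ => ⟨φ, dφ, h1, h2, h3, h4⟩,
    fun ⟨φ, dφ, h1, h2, h3, h4⟩ => ⟨φ, dφ, h1, h2, h3, h4⟩⟩

variable {f g f' g' : G.L2} {φ dφ φ' dφ' : E → ℝ → ℂ}

namespace IsRep

theorem continuousOn_deriv (h : G.IsRep f g φ dφ) (e : E) :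
    ContinuousOn (dφ e) (Icc 0 (G.len e)) :=
  (G.continuousOn_of_primitive g e _ (h.deriv_primitive e)).2

theorem integrableOn_deriv (h : G.IsRep f g φ dφ) (e : E) :
    IntegrableOn (dφ e) (Icc 0 (G.len e)) :=
  (h.continuousOn_deriv e).integrableOn_Icc

theorem continuousOn (h : G.IsRep f g φ dφ) (e : E) : ContinuousOn (φ e) (Icc 0 (G.len e)) := by
  refine ContinuousOn.congr ?_ (h.primitive e)
  exact continuousOn_const.add (intervalIntegral.continuousOn_primitive_interval'
    (intervalIntegrable_edge (G.right_mem_edge e) (h.integrableOn_deriv e))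
    (by simp) |>.mono (by rw [uIcc_of_le (G.len_pos e).le]))

theorem zero (G : MetricGraph V E) : G.IsRep 0 0 0 0 where
  ae_eq e := Lp.coeFn_zero ℂ 2 (G.edgeMeasure e)
  primitive e x _ := by simp
  deriv_primitive e x hx := by
    have : ∫ s in (0 : ℝ)..x, (0 : G.L2) e s = ∫ s in (0 : ℝ)..x, (0 : ℝ → ℂ) s :=
      G.integral_congr_edge hx (Lp.coeFn_zero ℂ 2 (G.edgeMeasure e))
    rw [this]
    simp
  boundary := ⟨⟨0, by simp, by simp⟩, by simp⟩

theorem add_smul (h : G.IsRep f g φ dφ) (c : ℂ) (h' : G.IsRep f' g' φ' dφ') :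
    G.IsRep (f + c • f') (g + c • g') (fun e x => φ e x + c * φ' e x)
      (fun e x => dφ e x + c * dφ' e x) where
  ae_eq e := by
    filter_upwards [Lp.coeFn_add (f e) (c • f' e), Lp.coeFn_smul c (f' e), h.ae_eq e, h'.ae_eq e]
      with x h1 h2 h3 h4
    rw [PiLp.add_apply, PiLp.smul_apply, h1, Pi.add_apply, h2, Pi.smul_apply, h3, h4, smul_eq_mul]
  primitive e x hx := by
    rw [intervalIntegral.integral_add (intervalIntegrable_edge hx (h.integrableOn_deriv e))
      ((intervalIntegrable_edge hx (h'.integrableOn_deriv e)).const_mul c),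
      intervalIntegral.integral_const_mul, h.primitive e x hx, h'.primitive e x hx]
    ring
  deriv_primitive e x hx := by
    have e1 : (g + c • g') e =ᵐ[G.edgeMeasure e] fun s => g e s + c * g' e s := by
      filter_upwards [Lp.coeFn_add (g e) (c • g' e), Lp.coeFn_smul c (g' e)] with x h1 h2
      rw [PiLp.add_apply, PiLp.smul_apply, h1, Pi.add_apply, h2, Pi.smul_apply, smul_eq_mul]
    rw [G.integral_congr_edge hx e1,
      intervalIntegral.integral_add (intervalIntegrable_edge hx (integrableOn_edge g e))
      ((intervalIntegrable_edge hx (integrableOn_edge g' e)).const_mul c),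
      intervalIntegral.integral_const_mul, h.deriv_primitive e x hx, h'.deriv_primitive e x hx]
    ring
  boundary := by
    obtain ⟨⟨val, hv, hd⟩, hk⟩ := h.boundary
    obtain ⟨⟨val', hv', hd'⟩, hk'⟩ := h'.boundary
    refine ⟨⟨val + c • val', fun e => ⟨?_, ?_⟩, fun v hdeg => ?_⟩, fun v hdeg => ?_⟩
    · simp [(hv e).1, (hv' e).1]
    · simp [(hv e).2, (hv' e).2]
    · simp [hd v hdeg, hd' v hdeg]
    · have a := hk v hdeg
      have b := hk' v hdeg
      simp only [Finset.sum_add_distrib, Finset.sum_neg_distrib, ← Finset.mul_sum] at a b ⊢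
      linear_combination a + c * b

theorem sum {ι : Type*} (s : Finset ι) {f g : ι → G.L2} {φ dφ : ι → E → ℝ → ℂ} (c : ι → ℂ)
    (h : ∀ i ∈ s, G.IsRep (f i) (g i) (φ i) (dφ i)) :
    G.IsRep (∑ i ∈ s, c i • f i) (∑ i ∈ s, c i • g i) (fun e x => ∑ i ∈ s, c i * φ i e x)
      (fun e x => ∑ i ∈ s, c i * dφ i e x) := by
  classical
  induction s using Finset.induction_on with
  | empty =>
    simp only [Finset.sum_empty]
    exact zero G
  | insert i s hi ih =>
    have := (ih fun j hj => h j (Finset.mem_insert_of_mem hj)).add_smul (c i)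
      (h i (Finset.mem_insert_self i s))
    simpa only [Finset.sum_insert hi, add_comm] using this

end IsRep

/-- A sum over the edge ends is rearranged to a sum over the vertices. -/
theorem sum_edges_eq_sum_vertices [Fintype V] (G : MetricGraph V E) (val : V → ℂ) (p q : E → ℂ) :
    ∑ e, (val (G.tgt e) * p e - val (G.src e) * q e) =
      ∑ v, val v * ((∑ e with G.tgt e = v, p e) + ∑ e with G.src e = v, -q e) := by
  simp_rw [mul_add, Finset.mul_sum, Finset.sum_add_distrib, Finset.sum_filter]
  rw [Finset.sum_comm, Finset.sum_comm (s := (Finset.univ : Finset V)), ← Finset.sum_add_distrib]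
  refine Finset.sum_congr rfl fun e _ => ?_
  simp [sub_eq_add_neg]

/-- The sum of `conj val` over the outgoing derivatives vanishes. -/
theorem IsRep.sum_boundary [Fintype V] (h : G.IsRep f g φ dφ) (h' : G.IsRep f' g' φ' dφ') :
    ∑ e, (conj (φ' e (G.len e)) * dφ e (G.len e) - conj (φ' e 0) * dφ e 0) = 0 := by
  obtain ⟨val, hv, hd⟩ := h'.boundary.continuous_and_dirichlet
  simp_rw [(hv _).1, (hv _).2]
  rw [G.sum_edges_eq_sum_vertices (fun v => conj (val v)) (fun e => dφ e (G.len e))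
    (fun e => dφ e 0)]
  refine Finset.sum_eq_zero fun v _ => ?_
  by_cases hdeg : G.degree v = 1
  · simp [hd v hdeg]
  · rw [h.boundary.kirchhoff v hdeg, mul_zero]

/-- Green's first identity on a metric graph. -/
theorem IsRep.inner_eq [Fintype V] (h : G.IsRep f g φ dφ) (h' : G.IsRep f' g' φ' dφ') :
    inner ℂ f' g = -∑ e, ∫ x in (0 : ℝ)..G.len e, conj (dφ' e x) * dφ e x := by
  have key : ∀ e, ∫ x in (0 : ℝ)..G.len e, conj (φ' e x) * g e x =
      (conj (φ' e (G.len e)) * dφ e (G.len e) - conj (φ' e 0) * dφ e 0) -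
        ∫ x in (0 : ℝ)..G.len e, conj (dφ' e x) * dφ e x := fun e => by
    refine integral_mul_of_primitive (φ := fun x => conj (φ' e x)) (u := fun x => conj (dφ' e x))
      (G.len_pos e).le ?_ (intervalIntegrable_edge (G.right_mem_edge e) (integrableOn_edge g e))
      (fun x hx => ?_) (h.deriv_primitive e)
    · refine ContinuousOn.intervalIntegrable ?_
      rw [uIcc_of_le (G.len_pos e).le]
      exact Complex.continuous_conj.comp_continuousOn (h'.continuousOn_deriv e)
    · rw [h'.primitive e x hx, map_add, intervalIntegral.integral_of_le hx.1,
        intervalIntegral.integral_of_le hx.1, integral_conj]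
  rw [inner_eq_sum_integral h'.ae_eq, Finset.sum_congr rfl fun e _ => key e,
    Finset.sum_sub_distrib, h.sum_boundary h', zero_sub]

theorem IsRep.inner_eq_neg_energy [Fintype V] (h : G.IsRep f g φ dφ) :
    inner ℂ f g = -(G.energy dφ : ℂ) := by
  rw [h.inner_eq h, energy, Complex.ofReal_sum]
  congr 1
  refine Finset.sum_congr rfl fun e _ => ?_
  rw [intervalIntegral.integral_of_le (G.len_pos e).le, ← integral_Icc_eq_integral_Ioc,
    ← integral_complex_ofReal]
  refine integral_congr_ae (.of_forall fun x => ?_)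
  simp [Complex.conj_mul']

theorem IsLaplacian.inner_symm [Fintype V] (h : G.IsLaplacian f g) (h' : G.IsLaplacian f' g') :
    inner ℂ f' g = inner ℂ g' f := by
  obtain ⟨φ, dφ, h⟩ := isLaplacian_iff_exists_isRep.1 h
  obtain ⟨φ', dφ', h'⟩ := isLaplacian_iff_exists_isRep.1 h'
  rw [← inner_conj_symm g' f, h.inner_eq h', h'.inner_eq h, map_neg, map_sum]
  congr 1
  refine Finset.sum_congr rfl fun e _ => ?_
  rw [intervalIntegral.integral_of_le (G.len_pos e).le, intervalIntegral.integral_of_le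
    (G.len_pos e).le, ← integral_conj]
  refine integral_congr_ae (.of_forall fun x => ?_)
  simp [mul_comm]

/-- Every connected component has a vertex of degree one: a function on the vertices which
takes equal values at the ends of every edge and vanishes at the vertices of degree one is zero. -/
def Anchored (G : MetricGraph V E) : Prop :=
  ∀ val : V → ℂ, (∀ e, val (G.src e) = val (G.tgt e)) → (∀ v, G.degree v = 1 → val v = 0) → val = 0

/-- A discrete Poincaré inequality: the vertex values are controlled by their increments along the
edges once they vanish at the vertices of degree one. Compactness in finite dimension replaces a
choice of paths. -/
theorem Anchored.exists_bound_vertices [Fintype V] (hG : G.Anchored) :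
    ∃ K : ℝ, 0 < K ∧ ∀ val : V → ℂ, (∀ v, G.degree v = 1 → val v = 0) →
      ∀ r, (∀ e, ‖val (G.tgt e) - val (G.src e)‖ ≤ r) → 0 ≤ r → ∀ v, ‖val v‖ ≤ K * r := by
  -- Increments and Dirichlet values together. `Anchored` says that this map is injective, and an
  -- injective linear map on a finite-dimensional space is bounded below.
  let D : (V → ℂ) →ₗ[ℂ] (E → ℂ) × (V → ℂ) :=
    { toFun val := (fun e => val (G.tgt e) - val (G.src e),
        fun v => if G.degree v = 1 then val v else 0)
      map_add' a b := by
        ext v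
        · simp [add_sub_add_comm]
        · simp only [Pi.add_apply, Prod.snd_add]
          split_ifs <;> simp
      map_smul' c a := by
        ext v
        · simp [mul_sub]
        · simp }
  have hD : LinearMap.ker D = ⊥ := by
    refine LinearMap.ker_eq_bot'.2 fun val h => hG val (fun e => ?_) fun v hv => ?_
    · have := congrFun (congrArg Prod.fst h) e
      exact (sub_eq_zero.1 this).symm
    · have := congrFun (congrArg Prod.snd h) v
      simpa [D, hv] using this
  obtain ⟨K, hK, hD⟩ := D.exists_antilipschitzWith hD
  refine ⟨K, hK, fun val hval r hr hr0 v => ?_⟩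
  have h1 := hD.le_mul_norm_sub (x := val) (y := 0)
  simp only [map_zero, add_zero, norm_neg] at h1
  refine (norm_le_pi_norm val v).trans (h1.trans ?_)
  refine mul_le_mul_of_nonneg_left ?_ hK.le
  refine norm_prod_le_iff.2 ⟨(pi_norm_le_iff_of_nonneg hr0).2 hr,
    (pi_norm_le_iff_of_nonneg hr0).2 fun v => ?_⟩
  by_cases hv : G.degree v = 1 <;> simp [D, hv, hval, hr0]

/-- Functions in the domain of the Laplacian are bounded by their Laplacian. -/
theorem Anchored.exists_bound [Fintype V] (hG : G.Anchored) :
    ∃ C : ℝ, 0 < C ∧ ∀ (f g : G.L2) (φ dφ : E → ℝ → ℂ), G.IsRep f g φ dφ →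
      ∀ e, ∀ x ∈ Icc 0 (G.len e), ‖φ e x‖ ^ 2 ≤ C * ‖g‖ ^ 2 := by
  obtain ⟨K, hK, hval⟩ := hG.exists_bound_vertices
  set Λ := ∑ e, G.len e
  have hΛ : 0 ≤ Λ := Finset.sum_nonneg fun e _ => (G.len_pos e).le
  set B := (K + 1) ^ 2 * Λ
  have hB : 0 ≤ B := by positivity
  refine ⟨B * (Λ * B) + 1, by positivity, fun f g φ dφ h => ?_⟩
  set M := G.energy dφ with hM
  have hM0 : 0 ≤ M := G.energy_nonneg dφ
  have h1 : ∀ e, ∀ x ∈ Icc 0 (G.len e), ‖∫ s in (0 : ℝ)..x, dφ e s‖ ≤ √(Λ * M) :=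
    fun e x hx => by
      refine Real.le_sqrt_of_sq_le ((norm_integral_sq_le (h.continuousOn_deriv e) hx).trans ?_)
      exact mul_le_mul (Finset.single_le_sum (fun e _ => (G.len_pos e).le) (Finset.mem_univ e))
        (G.integral_le_energy dφ e) (integral_nonneg fun _ => sq_nonneg _) hΛ
  obtain ⟨val, hv, hd⟩ := h.boundary.continuous_and_dirichlet
  have h2 : ∀ v, ‖val v‖ ≤ K * √(Λ * M) := by
    refine hval val hd _ (fun e => ?_) (Real.sqrt_nonneg _)
    rw [← (hv e).1, ← (hv e).2, h.primitive e _ (G.right_mem_edge e), add_sub_cancel_left]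
    exact h1 e _ (G.right_mem_edge e)
  have h3 : ∀ e, ∀ x ∈ Icc 0 (G.len e), ‖φ e x‖ ^ 2 ≤ B * M := fun e x hx => by
    have : ‖φ e x‖ ≤ (K + 1) * √(Λ * M) := by
      rw [h.primitive e x hx, (hv e).1, add_mul, one_mul]
      exact (norm_add_le _ _).trans (add_le_add (h2 _) (h1 e x hx))
    refine (pow_le_pow_left₀ (norm_nonneg _) this 2).trans_eq ?_
    rw [mul_pow, Real.sq_sqrt (by positivity)]
    ring
  have h4 : ‖f‖ ^ 2 ≤ Λ * (B * M) := norm_sq_le_of_ae_le fun e => by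
    filter_upwards [h.ae_eq e, ae_restrict_mem measurableSet_Icc] with x hx hxe
    rw [hx]
    exact h3 e x hxe
  have h5 : M ≤ ‖f‖ * ‖g‖ := by
    have := norm_inner_le_norm (𝕜 := ℂ) f g
    rw [h.inner_eq_neg_energy, norm_neg, Complex.norm_real, Real.norm_of_nonneg hM0] at this
    exact this
  -- Green's identity bounds the energy M by ‖f‖ ‖g‖, while ‖f‖² is at most a multiple of M.
  -- Squaring the former and cancelling one factor M removes f.
  have h6 : M ≤ Λ * B * ‖g‖ ^ 2 := by
    rcases hM0.eq_or_lt with h0 | h0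
    · rw [← h0]; positivity
    · refine le_of_mul_le_mul_right ?_ h0
      calc M * M ≤ (‖f‖ * ‖g‖) * (‖f‖ * ‖g‖) := mul_le_mul h5 h5 hM0 (by positivity)
        _ = ‖f‖ ^ 2 * ‖g‖ ^ 2 := by ring
        _ ≤ Λ * (B * M) * ‖g‖ ^ 2 := by gcongr
        _ = Λ * B * ‖g‖ ^ 2 * M := by ring
  intro e x hx
  calc ‖φ e x‖ ^ 2 ≤ B * M := h3 e x hx
    _ ≤ B * (Λ * B * ‖g‖ ^ 2) := by gcongr
    _ ≤ (B * (Λ * B) + 1) * ‖g‖ ^ 2 := by nlinarith [sq_nonneg ‖g‖]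

end MetricGraph

/-! ### The inverse Laplacian and its Hilbert–Schmidt bound -/

namespace MetricGraph

variable {V E : Type} [DecidableEq V] [Fintype E] {G : MetricGraph V E}

/-- The Laplacian is given as a relation; this says that it is single-valued. Continuity turns
almost everywhere vanishing of φ into vanishing everywhere, which passes to the derivative and then
to g. It is the injectivity of the inverse. -/
theorem isLaplacian_zero_left {g : G.L2} (h : G.IsLaplacian 0 g) : g = 0 := by
  obtain ⟨φ, dφ, h⟩ := isLaplacian_iff_exists_isRep.1 h
  have hφ : ∀ e, ∀ x ∈ Icc 0 (G.len e), φ e x = 0 := fun e x hx => by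
    have h1 : φ e =ᵐ[G.edgeMeasure e] 0 :=
      (h.ae_eq e).symm.trans (Lp.coeFn_zero ℂ 2 (G.edgeMeasure e))
    exact Measure.eqOn_Icc_of_ae_eq volume (G.len_pos e).ne h1 (h.continuousOn e)
      continuousOn_const hx
  have hdφ : ∀ e, ∀ x ∈ Icc 0 (G.len e), dφ e x = 0 := fun e x hx => by
    have h1 : dφ e =ᵐ[G.edgeMeasure e] 0 :=
      ae_eq_zero_of_primitive_eq_zero (G.len_pos e) (h.integrableOn_deriv e) fun y hy => by
        have := h.primitive e y hy
        rwa [hφ e y hy, hφ e 0 (left_mem_Icc.2 (G.len_pos e).le), zero_add, eq_comm] at this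
    exact Measure.eqOn_Icc_of_ae_eq volume (G.len_pos e).ne h1 (h.continuousOn_deriv e)
      continuousOn_const hx
  ext e : 1
  refine Lp.ext ((ae_eq_zero_of_primitive_eq_zero (G.len_pos e) (integrableOn_edge g e)
    fun y hy => ?_).trans (Lp.coeFn_zero ℂ 2 (G.edgeMeasure e)).symm)
  have := h.deriv_primitive e y hy
  rwa [hdφ e y hy, hdφ e 0 (left_mem_Icc.2 (G.len_pos e).le), zero_add, eq_comm] at this

variable [Fintype V]

/-- The sum of the derivatives directed into a vertex, for the piecewise linear function with the
given values at the vertices; at vertices of degree one, the value itself. -/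
def vertexOperator (G : MetricGraph V E) : (V → ℂ) →ₗ[ℂ] (V → ℂ) where
  toFun val v := if G.degree v = 1 then val v else
    (∑ e with G.tgt e = v, (val (G.tgt e) - val (G.src e)) / G.len e) +
      ∑ e with G.src e = v, -((val (G.tgt e) - val (G.src e)) / G.len e)
  map_add' a b := by
    ext v
    simp only [Pi.add_apply]
    split_ifs
    · rfl
    · rw [add_add_add_comm, ← Finset.sum_add_distrib, ← Finset.sum_add_distrib]
      congr 1 <;> exact Finset.sum_congr rfl fun e _ => by ring
  map_smul' c a := by
    ext v
    simp only [Pi.smul_apply, smul_eq_mul, RingHom.id_apply]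
    split_ifs
    · rfl
    · rw [mul_add, Finset.mul_sum, Finset.mul_sum]
      congr 1 <;> exact Finset.sum_congr rfl fun e _ => by ring

/-- Pairing with the conjugate of `val` and summing by parts gives the discrete energy ∑ |val (tgt
e) - val (src e)|² / len e. Its vanishing makes `val` agree at the two ends of every edge. -/
theorem Anchored.vertexOperator_injective (hG : G.Anchored) :
    Function.Injective G.vertexOperator := by
  refine (injective_iff_map_eq_zero _).2 fun val h => ?_
  have hd : ∀ v, G.degree v = 1 → val v = 0 := fun v hv => by
    have := congrFun h v
    simpa [vertexOperator, hv] using this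
  refine hG val (fun e => ?_) hd
  have h1 := G.sum_edges_eq_sum_vertices (fun v => conj (val v))
    (fun e => (val (G.tgt e) - val (G.src e)) / G.len e)
    (fun e => (val (G.tgt e) - val (G.src e)) / G.len e)
  rw [Finset.sum_eq_zero (s := (Finset.univ : Finset V)) fun v _ => ?_] at h1
  · have h2 : ∀ e, conj (val (G.tgt e)) * ((val (G.tgt e) - val (G.src e)) / G.len e) -
        conj (val (G.src e)) * ((val (G.tgt e) - val (G.src e)) / G.len e) =
        ((‖val (G.tgt e) - val (G.src e)‖ ^ 2 / G.len e : ℝ) : ℂ) := fun e => by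
      rw [← sub_mul, ← map_sub, ← mul_div_assoc, Complex.conj_mul']
      push_cast
      rfl
    simp_rw [h2] at h1
    rw [← Complex.ofReal_sum, Complex.ofReal_eq_zero, Finset.sum_eq_zero_iff_of_nonneg
      fun e _ => div_nonneg (sq_nonneg _) (G.len_pos e).le] at h1
    have h3 := h1 e (Finset.mem_univ e)
    rw [div_eq_zero_iff, or_iff_left (G.len_pos e).ne', sq_eq_zero_iff, norm_eq_zero,
      sub_eq_zero] at h3
    exact h3.symm
  · by_cases hv : G.degree v = 1
    · simp [hd v hv]
    · have := congrFun h v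
      simp only [vertexOperator, hv, LinearMap.coe_mk, AddHom.coe_mk, if_false,
        Pi.zero_apply] at this
      rw [this, mul_zero]

/-- Integrating g twice on each edge leaves the vertex values free. The Kirchhoff and Dirichlet
conditions are then a square linear system for them, solvable because it is injective. -/
theorem Anchored.exists_isLaplacian (hG : G.Anchored) (g : G.L2) : ∃ f, G.IsLaplacian f g := by
  let I : E → ℝ → ℂ := fun e x => ∫ s in (0 : ℝ)..x, g e s
  let J : E → ℂ := fun e => ∫ s in (0 : ℝ)..G.len e, I e s
  have hI : ∀ e, ContinuousOn (I e) (Icc 0 (G.len e)) := fun e =>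
    (G.continuousOn_of_primitive g e (I e) fun x _ => by simp [I]).2
  -- The right-hand side is minus the flux into v of the particular solution with second derivative
  -- g that is zero at both ends of every edge.
  obtain ⟨val, hval⟩ := (LinearMap.injective_iff_surjective.1 hG.vertexOperator_injective)
    fun v => if G.degree v = 1 then 0 else
      -((∑ e with G.tgt e = v, (I e (G.len e) - J e / G.len e)) +
        ∑ e with G.src e = v, J e / G.len e)
  have hd : ∀ v, G.degree v = 1 → val v = 0 := fun v hv => by
    have := congrFun hval v
    simpa [vertexOperator, hv] using this
  -- The initial slope for which integration starting from the value at `src e` arrives at the value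
  -- at `tgt e`.
  let β : E → ℂ := fun e => (val (G.tgt e) - val (G.src e)) / G.len e - J e / G.len e
  let dφ : E → ℝ → ℂ := fun e x => β e + I e x
  let φ : E → ℝ → ℂ := fun e x => val (G.src e) + ∫ s in (0 : ℝ)..x, dφ e s
  have hdφ : ∀ e, ContinuousOn (dφ e) (Icc 0 (G.len e)) := fun e => continuousOn_const.add (hI e)
  have hφ : ∀ e, ContinuousOn (φ e) (Icc 0 (G.len e)) := fun e =>
    continuousOn_const.add (intervalIntegral.continuousOn_primitive_interval'
      (intervalIntegrable_edge (G.right_mem_edge e) (hdφ e).integrableOn_Icc)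
      (by simp) |>.mono (by rw [uIcc_of_le (G.len_pos e).le]))
  have hφl : ∀ e, φ e (G.len e) = val (G.tgt e) := fun e => by
    have h0 : (G.len e : ℂ) ≠ 0 := Complex.ofReal_ne_zero.2 (G.len_pos e).ne'
    have : ∫ s in (0 : ℝ)..G.len e, dφ e s = G.len e * β e + J e := by
      rw [intervalIntegral.integral_add (by simp)
        (intervalIntegrable_edge (G.right_mem_edge e) (hI e).integrableOn_Icc)]
      simp [J]
    simp only [φ, this, β]
    field_simp
    ring
  refine ⟨WithLp.toLp 2 fun e => (memLp_of_continuousOn_edge e (hφ e)).toLp (φ e),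
    isLaplacian_iff_exists_isRep.2 ⟨φ, dφ, fun e => MemLp.coeFn_toLp (memLp_of_continuousOn_edge e (hφ e)), fun e x _ => ?_,
      fun e x _ => ?_, ⟨val, fun e => ⟨?_, hφl e⟩, hd⟩, fun v hv => ?_⟩⟩
  · simp [φ]
  · simp [dφ, I]
  · simp [φ]
  · have := congrFun hval v
    simp only [vertexOperator, hv, LinearMap.coe_mk, AddHom.coe_mk, if_false] at this
    simp only [dφ, β, I, intervalIntegral.integral_same, add_zero]
    simp only [Finset.sum_add_distrib, Finset.sum_sub_distrib, Finset.sum_neg_distrib, I] at this ⊢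
    linear_combination this

theorem Anchored.exists_norm_bound (hG : G.Anchored) :
    ∃ C : ℝ, 0 < C ∧ ∀ f g : G.L2, G.IsLaplacian f g → ‖f‖ ≤ C * ‖g‖ := by
  obtain ⟨C, hC, hb⟩ := hG.exists_bound
  have hΛ : 0 ≤ ∑ e, G.len e := Finset.sum_nonneg fun e _ => (G.len_pos e).le
  refine ⟨√((∑ e, G.len e) * C) + 1, by positivity, fun f g h => ?_⟩
  obtain ⟨φ, dφ, h⟩ := isLaplacian_iff_exists_isRep.1 h
  have h1 : ‖f‖ ^ 2 ≤ (∑ e, G.len e) * (C * ‖g‖ ^ 2) := norm_sq_le_of_ae_le fun e => by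
    filter_upwards [h.ae_eq e, ae_restrict_mem measurableSet_Icc] with x hx hxe
    rw [hx]
    exact hb f g φ dφ h e x hxe
  have h2 : ‖f‖ ≤ √((∑ e, G.len e) * C) * ‖g‖ := by
    rw [← abs_of_nonneg (norm_nonneg f), ← Real.sqrt_sq_eq_abs, ← Real.sqrt_sq (norm_nonneg g),
      ← Real.sqrt_mul' _ (sq_nonneg _), mul_assoc]
    exact Real.sqrt_le_sqrt h1
  nlinarith [norm_nonneg g]

theorem Anchored.isLaplacian_unique (hG : G.Anchored) {f f' g : G.L2} (h : G.IsLaplacian f g)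
    (h' : G.IsLaplacian f' g) : f = f' := by
  obtain ⟨C, -, hb⟩ := hG.exists_norm_bound
  have := hb _ _ (h.add (h'.smul (-1)))
  rw [neg_one_smul, neg_one_smul, add_neg_cancel, norm_zero, mul_zero, norm_le_zero_iff,
    ← sub_eq_add_neg, sub_eq_zero] at this
  exact this

/-- The inverse of the Laplacian. -/
def Anchored.inverse (hG : G.Anchored) : G.L2 →L[ℂ] G.L2 :=
  LinearMap.mkContinuous
    { toFun := fun g => (hG.exists_isLaplacian g).choose
      map_add' := fun a b => hG.isLaplacian_unique (hG.exists_isLaplacian (a + b)).choose_spec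
        ((hG.exists_isLaplacian a).choose_spec.add (hG.exists_isLaplacian b).choose_spec)
      map_smul' := fun c a => hG.isLaplacian_unique (hG.exists_isLaplacian (c • a)).choose_spec
        ((hG.exists_isLaplacian a).choose_spec.smul c) }
    hG.exists_norm_bound.choose
    fun g => hG.exists_norm_bound.choose_spec.2 _ _ (hG.exists_isLaplacian g).choose_spec

theorem Anchored.isLaplacian_inverse (hG : G.Anchored) (g : G.L2) :
    G.IsLaplacian (hG.inverse g) g :=
  (hG.exists_isLaplacian g).choose_spec

theorem Anchored.inverse_injective (hG : G.Anchored) : Function.Injective hG.inverse := by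
  refine (injective_iff_map_eq_zero _).2 fun g h => ?_
  have := hG.isLaplacian_inverse g
  rw [h] at this
  exact isLaplacian_zero_left this

theorem Anchored.inverse_isSymmetric (hG : G.Anchored) :
    (hG.inverse : G.L2 →ₗ[ℂ] G.L2).IsSymmetric := fun f g =>
  (hG.isLaplacian_inverse g).inner_symm (hG.isLaplacian_inverse f)

/-- The inverse of the Laplacian is a Hilbert–Schmidt operator. -/
theorem Anchored.exists_sum_norm_inverse_sq_le (hG : G.Anchored) :
    ∃ B : ℝ, ∀ {ι : Type} (v : ι → G.L2), Orthonormal ℂ v → ∀ s : Finset ι,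
      ∑ i ∈ s, ‖hG.inverse (v i)‖ ^ 2 ≤ B := by
  obtain ⟨C, hC, hb⟩ := hG.exists_bound
  refine ⟨(∑ e, G.len e) * C, fun {ι} v hv s => ?_⟩
  choose φ dφ hφ using fun i => isLaplacian_iff_exists_isRep.1 (hG.isLaplacian_inverse (v i))
  have key : ∀ e, ∀ x ∈ Icc 0 (G.len e), ∑ i ∈ s, ‖φ i e x‖ ^ 2 ≤ C := fun e x hx => by
    -- The sup bound at the fixed point x, for the combination with coefficients conj φ_i(x). With S
    -- = ∑ |φ_i(x)|² it reads S² ≤ C S, so S ≤ C independently of the finite set.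
    have h1 := hb _ _ _ _ (IsRep.sum s (fun i => conj (φ i e x)) fun i _ => hφ i) e x hx
    have h2 : ‖∑ i ∈ s, conj (φ i e x) • v i‖ ^ 2 = ∑ i ∈ s, ‖φ i e x‖ ^ 2 := by
      have := hv.inner_sum (fun i => conj (φ i e x)) (fun i => conj (φ i e x)) s
      rw [inner_self_eq_norm_sq_to_K] at this
      have e1 : ∀ i, conj (conj (φ i e x)) * conj (φ i e x) = ((‖φ i e x‖ ^ 2 : ℝ) : ℂ) :=
        fun i => by rw [Complex.conj_conj, Complex.mul_conj']; push_cast; rfl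
      simp_rw [e1] at this
      rw [← Complex.ofReal_sum] at this
      exact Complex.ofReal_injective (by rw [← this]; simp)
    have h3 : ‖∑ i ∈ s, conj (φ i e x) * φ i e x‖ = ∑ i ∈ s, ‖φ i e x‖ ^ 2 := by
      simp_rw [Complex.conj_mul']
      norm_cast
      exact Real.norm_of_nonneg (Finset.sum_nonneg fun _ _ => sq_nonneg _)
    rw [h2, h3] at h1
    have h4 : 0 ≤ ∑ i ∈ s, ‖φ i e x‖ ^ 2 := Finset.sum_nonneg fun _ _ => sq_nonneg _
    nlinarith
  calc ∑ i ∈ s, ‖hG.inverse (v i)‖ ^ 2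
      = ∑ e, ∑ i ∈ s, ∫ x in Icc 0 (G.len e), ‖φ i e x‖ ^ 2 := by
        rw [Finset.sum_comm]
        refine Finset.sum_congr rfl fun i _ => ?_
        rw [norm_sq_eq]
        refine Finset.sum_congr rfl fun e _ => integral_congr_ae ?_
        filter_upwards [(hφ i).ae_eq e] with x hx
        rw [hx]
    _ = ∑ e, ∫ x in Icc 0 (G.len e), ∑ i ∈ s, ‖φ i e x‖ ^ 2 :=
        Finset.sum_congr rfl fun e _ => (integral_finsetSum _ fun i _ =>
          (((hφ i).continuousOn e).norm.pow 2).integrableOn_Icc).symm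
    _ ≤ ∑ e, ∫ _ in Icc 0 (G.len e), C :=
        Finset.sum_le_sum fun e _ => setIntegral_mono_on
          (continuousOn_finsetSum _ fun i _ => (((hφ i).continuousOn e).norm.pow 2)).integrableOn_Icc
          (by simp) measurableSet_Icc (key e)
    _ = (∑ e, G.len e) * C := by
        rw [Finset.sum_mul]
        exact Finset.sum_congr rfl fun e _ => by simp [(G.len_pos e).le]

end MetricGraph

/-! ### Hilbert–Schmidt operators and diagonalisation -/

section HilbertSchmidt

open Filter Topology

variable {ι H : Type*} [NormedAddCommGroup H] [InnerProductSpace ℂ H]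

/-- Hilbert–Schmidt operators are compact. -/
theorem HilbertBasis.isCompactOperator_of_summable [CompleteSpace H] (b : HilbertBasis ι ℂ H)
    (T : H →L[ℂ] H) (hT : Summable fun i => ‖T (b i)‖ ^ 2) : IsCompactOperator T := by
  classical
  -- Finite-rank truncations. They converge to T in operator norm: Cauchy–Schwarz and Bessel bound
  -- the remainder by the tail of ∑ ‖T b_i‖².
  let R : Finset ι → H →L[ℂ] H := fun s =>
    ∑ i ∈ s, (innerSL ℂ (b i)).smulRight (T (b i))
  have hR : ∀ s, IsCompactOperator (R s) := fun s => by
    refine (compactOperator (RingHom.id ℂ) H H).sum_mem fun i _ => ?_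
    exact (isCompactOperator_of_locallyCompactSpace_dom (innerSL ℂ (b i))).clm_comp
      (ContinuousLinearMap.toSpanSingleton ℂ (T (b i)))
  refine isCompactOperator_of_tendsto (l := atTop) (F := R) ?_ (Eventually.of_forall hR)
  refine Metric.tendsto_atTop.2 fun ε hε => ?_
  obtain ⟨s₀, hs₀⟩ := summable_iff_vanishing_norm.1 hT ((ε / 2) ^ 2) (by positivity)
  refine ⟨s₀, fun s hs => ?_⟩
  rw [dist_eq_norm, norm_sub_rev]
  refine lt_of_le_of_lt (ContinuousLinearMap.opNorm_le_bound _ (half_pos hε).le fun x => ?_)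
    (half_lt_self hε)
  have h1 : HasSum (fun i => inner ℂ (b i) x • T (b i)) (T x) := by
    have := (b.hasSum_repr x).mapL T
    simpa [b.repr_apply_apply] using this
  have h2 : Tendsto (fun t => ‖∑ i ∈ t, inner ℂ (b i) x • T (b i) - R s x‖) atTop
      (𝓝 ‖T x - R s x‖) := (h1.sub_const (R s x)).norm
  refine le_of_tendsto h2 ((eventually_ge_atTop s).mono fun t ht => ?_)
  have h3 : ∑ i ∈ t, inner ℂ (b i) x • T (b i) - R s x =
      ∑ i ∈ t \ s, inner ℂ (b i) x • T (b i) := by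
    rw [← Finset.sum_sdiff ht]
    simp [R]
  rw [h3]
  have h4 : ∑ i ∈ t \ s, ‖T (b i)‖ ^ 2 < (ε / 2) ^ 2 := by
    have := hs₀ (t \ s) (Finset.sdiff_disjoint.mono_right hs)
    rwa [Real.norm_of_nonneg (Finset.sum_nonneg fun _ _ => sq_nonneg _)] at this
  calc ‖∑ i ∈ t \ s, inner ℂ (b i) x • T (b i)‖
      ≤ ∑ i ∈ t \ s, ‖inner ℂ (b i) x‖ * ‖T (b i)‖ :=
        (norm_sum_le _ _).trans_eq (Finset.sum_congr rfl fun _ _ => norm_smul _ _)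
    _ ≤ √(∑ i ∈ t \ s, ‖inner ℂ (b i) x‖ ^ 2) * √(∑ i ∈ t \ s, ‖T (b i)‖ ^ 2) :=
        Real.sum_mul_le_sqrt_mul_sqrt _ _ _
    _ ≤ ‖x‖ * (ε / 2) := by
        gcongr
        · exact Real.sqrt_le_iff.2 ⟨norm_nonneg _, b.orthonormal.sum_inner_products_le x⟩
        · exact Real.sqrt_le_iff.2 ⟨(half_pos hε).le, h4.le⟩
    _ = ε / 2 * ‖x‖ := mul_comm _ _

/-- An injective compact symmetric operator has an orthonormal basis of eigenvectors. -/
theorem exists_orthonormal_eigenvectors [CompleteSpace H] {T : H →L[ℂ] H}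
    (hc : IsCompactOperator T) (hs : T.IsSymmetric) (hi : Function.Injective T) :
    ∃ (ι : Type) (v : ι → H) (κ : ι → ℝ), Orthonormal ℂ v ∧
      (Submodule.span ℂ (range v))ᗮ = ⊥ ∧ ∀ i, κ i ≠ 0 ∧ T (v i) = (κ i : ℂ) • v i := by
  let W : ℂ → Submodule ℂ H := Module.End.eigenspace (T : Module.End ℂ H)
  have hW : ∀ μ x, x ∈ W μ ↔ T x = μ • x := fun μ x => Module.End.mem_eigenspace_iff
  -- Compactness makes the eigenspaces for nonzero eigenvalues finite-dimensional; the kernel has to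
  -- be excluded separately.
  have h0 : W 0 = ⊥ := by
    refine (Submodule.eq_bot_iff _).2 fun x hx => hi ?_
    rw [(hW 0 x).1 hx, zero_smul, map_zero]
  have hfin : ∀ μ, FiniteDimensional ℂ (W μ) := fun μ => by
    by_cases hμ : μ = 0
    · rw [hμ, h0]; infer_instance
    · exact ContinuousLinearMap.finite_dimensional_eigenspace hc μ hμ
  let e : ∀ μ, OrthonormalBasis (Fin (Module.finrank ℂ (W μ))) ℂ (W μ) :=
    fun μ => stdOrthonormalBasis ℂ (W μ)
  let v : (Σ μ : ℂ, Fin (Module.finrank ℂ (W μ))) → H := fun a => (e a.1 a.2 : H)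
  have hv : Orthonormal ℂ v :=
    hs.orthogonalFamily_eigenspaces.orthonormal_sigma_orthonormal fun μ => (e μ).orthonormal
  have hT : ∀ a, T (v a) = a.1 • v a := fun a => (hW _ _).1 (e a.1 a.2).2
  have hreal : ∀ a : (Σ μ : ℂ, Fin (Module.finrank ℂ (W μ))), ((a.1.re : ℝ) : ℂ) = a.1 :=
    fun a => Complex.conj_eq_iff_re.1 (hs.conj_eigenvalue_eq_self
      (Module.End.hasEigenvalue_of_hasEigenvector ⟨(e a.1 a.2).2, hv.ne_zero a⟩))
  refine ⟨_, v, fun a => a.1.re, hv, ?_, fun a => ⟨fun h => ?_, ?_⟩⟩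
  · rw [eq_bot_iff, ← ContinuousLinearMap.orthogonalComplement_iSup_eigenspaces_eq_bot hc hs]
    refine Submodule.orthogonal_le (iSup_le fun μ x hx => ?_)
    have h1 := congrArg Subtype.val ((e μ).sum_repr ⟨x, hx⟩)
    rw [Submodule.coe_sum] at h1
    rw [show x = _ from h1.symm]
    exact Submodule.sum_mem _ fun i _ =>
      Submodule.smul_mem _ _ (Submodule.subset_span ⟨⟨μ, i⟩, rfl⟩)
  · have h1 : a.1 = 0 := by
      rw [← hreal a, show a.1.re = 0 from h, Complex.ofReal_zero]
    have h2 := hT a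
    rw [h1, zero_smul] at h2
    exact hv.ne_zero a (hi (by rw [h2, map_zero]))
  · rw [hreal a, hT a]

end HilbertSchmidt

/-! ### Existence of an orthonormal basis of eigenfunctions -/

namespace MetricGraph

variable {V E : Type}

/-- Polynomials embed into L² of a single edge. This is needed because the eigenfunctions must be
indexed by all of ℕ. -/
theorem not_finiteDimensional_L2 [Fintype E] [Nonempty E] (G : MetricGraph V E) :
    ¬ FiniteDimensional ℂ G.L2 := by
  classical
  intro hfin
  obtain ⟨e₀⟩ := ‹Nonempty E›
  have hp : ∀ p : Polynomial ℂ, MemLp (fun x : ℝ => p.eval (x : ℂ)) 2 (G.edgeMeasure e₀) :=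
    fun p => memLp_of_continuousOn_edge (φ := fun _ x => p.eval (x : ℂ)) e₀ (by fun_prop)
  let Φ : Polynomial ℂ →ₗ[ℂ] Lp ℂ 2 (G.edgeMeasure e₀) :=
    { toFun p := (hp p).toLp
      map_add' p q := by
        rw [← MemLp.toLp_add]
        exact MemLp.toLp_congr _ _ (.of_forall fun x => by simp)
      map_smul' c p := by
        rw [RingHom.id_apply, ← MemLp.toLp_const_smul]
        exact MemLp.toLp_congr _ _ (.of_forall fun x => by simp) }
  have hΦ : Function.Injective Φ := by
    refine (injective_iff_map_eq_zero _).2 fun p h => ?_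
    have h1 : (fun x : ℝ => p.eval (x : ℂ)) =ᵐ[G.edgeMeasure e₀] 0 :=
      ((hp p).coeFn_toLp.symm.trans (by rw [show (hp p).toLp _ = 0 from h])).trans
        (Lp.coeFn_zero ℂ 2 (G.edgeMeasure e₀))
    have h2 : EqOn (fun x : ℝ => p.eval (x : ℂ)) 0 (Icc 0 (G.len e₀)) :=
      Measure.eqOn_Icc_of_ae_eq volume (G.len_pos e₀).ne h1 (by fun_prop) continuousOn_const
    refine Polynomial.eq_zero_of_infinite_isRoot p
      (((Icc_infinite (G.len_pos e₀)).image Complex.ofReal_injective.injOn).mono ?_)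
    rintro _ ⟨x, hx, rfl⟩
    exact h2 hx
  have hproj : Function.Surjective
      (LinearMap.proj (R := ℂ) (φ := fun e => Lp ℂ 2 (G.edgeMeasure e)) e₀ ∘ₗ
        (WithLp.linearEquiv 2 ℂ (∀ e, Lp ℂ 2 (G.edgeMeasure e))).toLinearMap) :=
    fun y => ⟨WithLp.toLp 2 (Pi.single e₀ y), by simp⟩
  have : FiniteDimensional ℂ (Lp ℂ 2 (G.edgeMeasure e₀)) := Module.Finite.of_surjective _ hproj
  exact Polynomial.not_finite (R := ℂ) (Module.Finite.of_injective Φ hΦ)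

variable [DecidableEq V] [Fintype E] [Fintype V] {G : MetricGraph V E}

theorem Anchored.inverse_isCompactOperator (hG : G.Anchored) : IsCompactOperator hG.inverse := by
  obtain ⟨w, b, hb⟩ := exists_hilbertBasis ℂ G.L2
  obtain ⟨B, hB⟩ := hG.exists_sum_norm_inverse_sq_le
  exact b.isCompactOperator_of_summable _
    (summable_of_sum_le (fun _ => sq_nonneg _) (hB b b.orthonormal))

theorem Anchored.nonempty_spectralResolution [Nonempty E] (hG : G.Anchored) :
    Nonempty G.SpectralResolution := by
  obtain ⟨ι, v, κ, hv, hspan, hκ⟩ := exists_orthonormal_eigenvectors hG.inverse_isCompactOperator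
    hG.inverse_isSymmetric hG.inverse_injective
  obtain ⟨B, hB⟩ := hG.exists_sum_norm_inverse_sq_le
  -- The numbers ‖Δ⁻¹ v_i‖² are summable and all nonzero, so there are only countably many of them.
  have hcount : Countable ι := by
    have h1 : Summable fun i => ‖hG.inverse (v i)‖ ^ 2 :=
      summable_of_sum_le (fun _ => sq_nonneg _) (hB v hv)
    have h2 : Function.support (fun i => ‖hG.inverse (v i)‖ ^ 2) = univ := by
      refine eq_univ_of_forall fun i => ?_
      rw [Function.mem_support, (hκ i).2]
      exact pow_ne_zero 2 (norm_ne_zero_iff.2 (smul_ne_zero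
        (Complex.ofReal_ne_zero.2 (hκ i).1) (hv.ne_zero i)))
    have h3 := h1.countable_support
    rwa [h2, countable_univ_iff] at h3
  have hinf : Infinite ι := by
    by_contra h
    rw [not_infinite_iff_finite] at h
    have := Fintype.ofFinite ι
    have hb := (HilbertBasis.mkOfOrthogonalEqBot hv hspan).toOrthonormalBasis
    exact G.not_finiteDimensional_L2 hb.toBasis.finiteDimensional_of_finite
  obtain ⟨e⟩ : Nonempty (ℕ ≃ ι) := by
    obtain ⟨h⟩ := nonempty_denumerable ι
    exact ⟨(Denumerable.eqv ι).symm⟩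
  have hspan' : (Submodule.span ℂ (range (v ∘ e)))ᗮ = ⊥ := by
    rwa [e.surjective.range_comp]
  refine ⟨⟨HilbertBasis.mkOfOrthogonalEqBot (hv.comp e e.injective) hspan',
    fun n => -(κ (e n))⁻¹, fun n => ?_⟩⟩
  rw [HilbertBasis.coe_mkOfOrthogonalEqBot]
  -- An eigenvalue κ of Δ⁻¹ corresponds to the eigenvalue -κ⁻¹ of -Δ.
  have h1 := (hG.isLaplacian_inverse (v (e n))).smul ((κ (e n) : ℂ)⁻¹)
  have h0 : (κ (e n) : ℂ) ≠ 0 := Complex.ofReal_ne_zero.2 (hκ _).1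
  rw [(hκ (e n)).2, inv_smul_smul₀ h0] at h1
  change G.IsLaplacian (v (e n)) (-(((-(κ (e n))⁻¹ : ℝ) : ℂ) • v (e n)))
  rwa [Complex.ofReal_neg, Complex.ofReal_inv, neg_smul, neg_neg]

end MetricGraph

/-! ### The heat content as a spectral series, and its time integral -/

/-- Termwise integration of a series of functions which is dominated by a summable sequence. -/
theorem hasSum_integral_of_ae_norm_le {α : Type*} [MeasurableSpace α] {μ : Measure α}
    [IsFiniteMeasure μ] {F : ℕ → α → ℂ} {b : ℕ → ℝ} (hF : ∀ n, AEStronglyMeasurable (F n) μ)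
    (hb : ∀ n, ∀ᵐ x ∂μ, ‖F n x‖ ≤ b n) (hs : Summable b) :
    HasSum (fun n => ∫ x, F n x ∂μ) (∫ x, ∑' n, F n x ∂μ) := by
  refine hasSum_integral_of_dominated_convergence (fun n _ => b n) hF hb
    (.of_forall fun _ => hs) (integrable_const _) ?_
  filter_upwards [ae_all_iff.2 hb] with x hx
  exact (Summable.of_norm_bounded hs hx).hasSum

namespace MetricGraph

variable {V E : Type}

/-- The constant function `1` as an element of `L²`. -/
def one [Fintype E] (G : MetricGraph V E) : G.L2 :=
  WithLp.toLp 2 fun e => Lp.const 2 (G.edgeMeasure e) (1 : ℂ)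

theorem one_ae_eq [Fintype E] (G : MetricGraph V E) (e : E) :
    G.one e =ᵐ[G.edgeMeasure e] fun _ => 1 :=
  Lp.coeFn_const 2 (G.edgeMeasure e) (1 : ℂ)

theorem inner_one [Fintype E] {G : MetricGraph V E} (f : G.L2) :
    inner ℂ G.one f = ∑ e, ∫ x in Icc 0 (G.len e), f e x := by
  rw [inner_eq_sum_integral G.one_ae_eq]
  refine Finset.sum_congr rfl fun e _ => ?_
  rw [intervalIntegral.integral_of_le (G.len_pos e).le, integral_Icc_eq_integral_Ioc]
  simp

variable [DecidableEq V] [Fintype E] {G : MetricGraph V E}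

namespace SpectralResolution

variable (S : G.SpectralResolution)

theorem norm_basis (n : ℕ) : ‖S.basis n‖ = 1 := S.basis.orthonormal.1 n

variable [Fintype V]

/-- The eigenvalue is the energy of a unit eigenfunction, hence nonnegative; if it were 0, the norm
bound for the inverse would give ‖φ_n‖ ≤ 0. -/
theorem eigenvalue_pos (hG : G.Anchored) (n : ℕ) : 0 < S.eigenvalue n := by
  have hL : G.IsLaplacian (S.basis n) (-((S.eigenvalue n : ℂ) • S.basis n)) := S.isLaplacian n
  obtain ⟨φ, dφ, h⟩ := isLaplacian_iff_exists_isRep.1 hL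
  have h1 := h.inner_eq_neg_energy
  rw [inner_neg_right, inner_smul_right, inner_self_eq_norm_sq_to_K, S.norm_basis, neg_inj] at h1
  have h2 : S.eigenvalue n = G.energy dφ := Complex.ofReal_injective (by simpa using h1)
  refine (h2 ▸ G.energy_nonneg dφ).lt_of_ne fun h0 => ?_
  obtain ⟨C, -, hC⟩ := hG.exists_norm_bound
  have h3 := hC _ _ hL
  rw [← h0] at h3
  simp [S.norm_basis] at h3
  linarith

theorem inverse_basis (hG : G.Anchored) (n : ℕ) :
    hG.inverse (S.basis n) = -((S.eigenvalue n : ℂ)⁻¹ • S.basis n) := by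
  have h0 : (S.eigenvalue n : ℂ) ≠ 0 := Complex.ofReal_ne_zero.2 (S.eigenvalue_pos hG n).ne'
  have hL : G.IsLaplacian (S.basis n) (-((S.eigenvalue n : ℂ) • S.basis n)) := S.isLaplacian n
  have h1 := hL.smul (-(S.eigenvalue n : ℂ)⁻¹)
  rw [smul_neg, neg_smul, neg_smul, neg_neg, inv_smul_smul₀ h0] at h1
  exact hG.isLaplacian_unique (hG.isLaplacian_inverse _) h1

theorem summable_inv_eigenvalue_sq (hG : G.Anchored) :
    Summable fun n => (S.eigenvalue n ^ 2)⁻¹ := by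
  obtain ⟨B, hB⟩ := hG.exists_sum_norm_inverse_sq_le
  refine (summable_of_sum_le (fun _ => sq_nonneg _) (hB S.basis S.basis.orthonormal)).congr
    fun n => ?_
  rw [S.inverse_basis hG, norm_neg, norm_smul, S.norm_basis, norm_inv, Complex.norm_real, mul_one,
    inv_pow, Real.norm_eq_abs, sq_abs]

theorem summable_exp_mul_pow (hG : G.Anchored) {t : ℝ} (ht : 0 < t) (k : ℕ) :
    Summable fun n => Real.exp (-S.eigenvalue n * t) * S.eigenvalue n ^ k := by
  refine Summable.of_nonneg_of_le (fun n => ?_) (fun n => ?_)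
    ((S.summable_inv_eigenvalue_sq hG).mul_left (((k + 2).factorial : ℝ) / t ^ (k + 2)))
  · have := S.eigenvalue_pos hG n
    positivity
  · have h0 := S.eigenvalue_pos hG n
    -- The exponent k + 2 absorbs λ^k and leaves the summable λ⁻².
    have h1 := Real.pow_div_factorial_le_exp _ (mul_pos h0 ht).le (k + 2)
    have hf : (0 : ℝ) < (k + 2).factorial := by positivity
    rw [neg_mul, Real.exp_neg]
    calc (Real.exp (S.eigenvalue n * t))⁻¹ * S.eigenvalue n ^ k
        ≤ ((S.eigenvalue n * t) ^ (k + 2) / (k + 2).factorial)⁻¹ * S.eigenvalue n ^ k := by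
          gcongr
      _ = (k + 2).factorial / t ^ (k + 2) * (S.eigenvalue n ^ 2)⁻¹ := by
          field_simp
          ring

/-- The a priori estimate applied to Δφ_n = -λ_n φ_n. It holds only almost everywhere because the
heat kernel is formed with arbitrary representatives of the L² classes; this suffices for the
integrals. -/
theorem exists_ae_norm_basis_le (hG : G.Anchored) :
    ∃ D : ℝ, 0 ≤ D ∧ ∀ e, ∀ᵐ x ∂G.edgeMeasure e, ∀ n, ‖S.basis n e x‖ ≤ D * S.eigenvalue n := by
  obtain ⟨C, hC, hb⟩ := hG.exists_bound
  refine ⟨√C, Real.sqrt_nonneg _, fun e => ae_all_iff.2 fun n => ?_⟩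
  obtain ⟨φ, dφ, h⟩ := isLaplacian_iff_exists_isRep.1
    (show G.IsLaplacian (S.basis n) (-((S.eigenvalue n : ℂ) • S.basis n)) from S.isLaplacian n)
  filter_upwards [h.ae_eq e, ae_restrict_mem measurableSet_Icc] with x hx hxe
  have h0 := S.eigenvalue_pos hG n
  have h1 := hb _ _ _ _ h e x hxe
  rw [norm_neg, norm_smul, S.norm_basis, Complex.norm_real, mul_one, Real.norm_of_nonneg h0.le]
    at h1
  rw [hx]
  refine abs_le_of_sq_le_sq' ?_ (by positivity) |>.2
  rwa [mul_pow, Real.sq_sqrt hC.le]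

/-- The integral of the heat kernel over the second variable. -/
theorem hasSum_integral_heatKernel (hG : G.Anchored) {t : ℝ} (ht : 0 < t) {D : ℝ} (hD0 : 0 ≤ D)
    (hD : ∀ e, ∀ᵐ x ∂G.edgeMeasure e, ∀ n, ‖S.basis n e x‖ ≤ D * S.eigenvalue n) (e : E) {x : ℝ}
    (hx : ∀ n, ‖S.basis n e x‖ ≤ D * S.eigenvalue n) :
    HasSum (fun n => (Real.exp (-S.eigenvalue n * t) : ℂ) * S.basis n e x *
      conj (inner ℂ G.one (S.basis n)))
      (∑ e', ∫ y in Icc 0 (G.len e'), S.heatKernel t e x e' y) := by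
  simp_rw [inner_one, map_sum, Finset.mul_sum]
  refine hasSum_sum fun e' _ => ?_
  have h1 := hasSum_integral_of_ae_norm_le (μ := G.edgeMeasure e')
    (F := fun n y => (Real.exp (-S.eigenvalue n * t) : ℂ) * S.basis n e x * conj (S.basis n e' y))
    (b := fun n => Real.exp (-S.eigenvalue n * t) * S.eigenvalue n ^ 2 * D ^ 2)
    (fun n => ((Lp.aestronglyMeasurable (S.basis n e')).star).const_mul _) (fun n => ?_)
    ((S.summable_exp_mul_pow hG ht 2).mul_right _)
  · refine h1.congr_fun fun n => ?_
    rw [integral_const_mul, integral_conj]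
  · filter_upwards [hD e'] with y hy
    rw [norm_mul, norm_mul, Complex.norm_real, Real.norm_of_nonneg (Real.exp_pos _).le,
      RCLike.norm_conj]
    have h0 := S.eigenvalue_pos hG n
    calc Real.exp (-S.eigenvalue n * t) * ‖S.basis n e x‖ * ‖S.basis n e' y‖
        ≤ Real.exp (-S.eigenvalue n * t) * (D * S.eigenvalue n) * (D * S.eigenvalue n) := by
          gcongr
          · exact hx n
          · exact hy n
      _ = Real.exp (-S.eigenvalue n * t) * S.eigenvalue n ^ 2 * D ^ 2 := by ring

/-- Integrating the kernel series termwise in both variables turns each term into e^{-λ_n t} |⟨1,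
φ_n⟩|². The factor e^{-λ_n t} dominates the polynomial growth in λ_n of the eigenfunction bounds. -/
theorem hasSum_heatContent (hG : G.Anchored) {t : ℝ} (ht : 0 < t) :
    HasSum (fun n => (Real.exp (-S.eigenvalue n * t) : ℂ) *
      ((‖inner ℂ G.one (S.basis n)‖ ^ 2 : ℝ) : ℂ)) (S.heatContent t) := by
  obtain ⟨D, hD0, hD⟩ := S.exists_ae_norm_basis_le hG
  have h1 : ∀ e, HasSum (fun n => ∫ x in Icc 0 (G.len e), (Real.exp (-S.eigenvalue n * t) : ℂ) *
      S.basis n e x * conj (inner ℂ G.one (S.basis n)))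
      (∫ x in Icc 0 (G.len e), ∑ e', ∫ y in Icc 0 (G.len e'), S.heatKernel t e x e' y) := by
    intro e
    rw [show ∫ x in Icc 0 (G.len e), ∑ e', ∫ y in Icc 0 (G.len e'), S.heatKernel t e x e' y =
        ∫ x in Icc 0 (G.len e), ∑' n, (Real.exp (-S.eigenvalue n * t) : ℂ) * S.basis n e x *
          conj (inner ℂ G.one (S.basis n)) from integral_congr_ae (by
      filter_upwards [hD e] with x hx
      exact (S.hasSum_integral_heatKernel hG ht hD0 hD e hx).tsum_eq.symm)]
    refine hasSum_integral_of_ae_norm_le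
      (b := fun n => Real.exp (-S.eigenvalue n * t) * S.eigenvalue n ^ 1 * (D * ‖G.one‖))
      (fun n => ((Lp.aestronglyMeasurable (S.basis n e)).const_mul _).mul_const _) (fun n => ?_)
      ((S.summable_exp_mul_pow hG ht 1).mul_right _)
    filter_upwards [hD e] with x hx
    rw [norm_mul, norm_mul, Complex.norm_real, Real.norm_of_nonneg (Real.exp_pos _).le,
      RCLike.norm_conj]
    have h0 := S.eigenvalue_pos hG n
    have h2 : ‖inner ℂ G.one (S.basis n)‖ ≤ ‖G.one‖ := by
      simpa [S.norm_basis] using norm_inner_le_norm (𝕜 := ℂ) G.one (S.basis n)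
    calc Real.exp (-S.eigenvalue n * t) * ‖S.basis n e x‖ * ‖inner ℂ G.one (S.basis n)‖
        ≤ Real.exp (-S.eigenvalue n * t) * (D * S.eigenvalue n) * ‖G.one‖ := by
          gcongr
          exact hx n
      _ = Real.exp (-S.eigenvalue n * t) * S.eigenvalue n ^ 1 * (D * ‖G.one‖) := by ring
  have h2 := hasSum_sum fun e (_ : e ∈ Finset.univ) => h1 e
  refine h2.congr_fun fun n => ?_
  simp_rw [integral_mul_const, integral_const_mul]
  rw [← Finset.sum_mul, ← Finset.mul_sum, ← inner_one, mul_assoc, Complex.mul_conj']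
  push_cast
  rfl

/-- The integral of the heat content over all times is the torsional rigidity. -/
theorem integral_heatContent (hG : G.Anchored) :
    ∫ t in Ioi (0 : ℝ), S.heatContent t = -inner ℂ G.one (hG.inverse G.one) := by
  have h0 := S.eigenvalue_pos hG
  have hsum : HasSum (fun n => ((‖inner ℂ G.one (S.basis n)‖ ^ 2 / S.eigenvalue n : ℝ) : ℂ))
      (-inner ℂ G.one (hG.inverse G.one)) := by
    refine (S.basis.hasSum_inner_mul_inner G.one (hG.inverse G.one)).neg.congr_fun fun n => ?_
    have h1 : inner ℂ (S.basis n) (hG.inverse G.one) =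
        -((S.eigenvalue n : ℂ)⁻¹ * inner ℂ (S.basis n) G.one) := by
      have := hG.inverse_isSymmetric (S.basis n) G.one
      simp only [ContinuousLinearMap.coe_coe] at this
      rw [← this, S.inverse_basis hG, inner_neg_left, inner_smul_left, map_inv₀,
        Complex.conj_ofReal]
    rw [h1, ← inner_conj_symm (S.basis n) G.one, mul_neg, neg_neg, mul_left_comm,
      Complex.mul_conj', div_eq_inv_mul]
    push_cast
    rfl
  have hint : ∀ n, IntegrableOn (fun t => Real.exp (-S.eigenvalue n * t)) (Ioi 0) := fun n =>
    integrableOn_exp_mul_Ioi (neg_lt_zero.2 (h0 n)) 0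
  have hval : ∀ n, ∫ t in Ioi (0 : ℝ), Real.exp (-S.eigenvalue n * t) = (S.eigenvalue n)⁻¹ :=
    fun n => by
      rw [integral_exp_mul_Ioi (neg_lt_zero.2 (h0 n)) 0]
      simp [neg_div_neg_eq]
  have hF : HasSum (fun n => ∫ t in Ioi (0 : ℝ), (Real.exp (-S.eigenvalue n * t) : ℂ) *
      ((‖inner ℂ G.one (S.basis n)‖ ^ 2 : ℝ) : ℂ)) (∫ t in Ioi (0 : ℝ), ∑' n,
      (Real.exp (-S.eigenvalue n * t) : ℂ) * ((‖inner ℂ G.one (S.basis n)‖ ^ 2 : ℝ) : ℂ)) := by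
    -- The terms are nonnegative, so the integrals of their norms are again the terms of `hsum`.
    refine hasSum_integral_of_summable_integral_norm (fun n => (hint n).ofReal.mul_const _) ?_
    refine (Complex.summable_ofReal.1 hsum.summable).congr fun n => ?_
    simp_rw [norm_mul, Complex.norm_real, Real.norm_of_nonneg (Real.exp_pos _).le]
    rw [integral_mul_const, hval, Real.norm_of_nonneg (sq_nonneg _), div_eq_inv_mul]
  rw [show ∫ t in Ioi (0 : ℝ), S.heatContent t = ∫ t in Ioi (0 : ℝ), ∑' n,
      (Real.exp (-S.eigenvalue n * t) : ℂ) * ((‖inner ℂ G.one (S.basis n)‖ ^ 2 : ℝ) : ℂ) from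
    setIntegral_congr_fun measurableSet_Ioi fun t ht => (S.hasSum_heatContent hG ht).tsum_eq.symm]
  refine hF.unique (hsum.congr_fun fun n => ?_)
  rw [integral_mul_const, integral_complex_ofReal, hval, ← Complex.ofReal_mul, div_eq_inv_mul]

end SpectralResolution

end MetricGraph

/-! ### Star graphs: boundary conditions as reflections -/

namespace Gluing

open MetricGraph

/-- `-1` on boundary sides and `1` on interior sides. -/
def sign (σ : Gluing) (k : Fin 3) (i : Fin 7) : ℤ := if σ.glue k i = i then -1 else 1

theorem sign_glue (σ : Gluing) (k : Fin 3) (i : Fin 7) : σ.sign k (σ.glue k i) = σ.sign k i := by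
  simp only [sign, EmbeddingLike.apply_eq_iff_eq]

section Star

variable (σ : Gluing) (l : Fin 3 → ℝ) (hl : ∀ k, 0 < l k)

/-- An outer vertex is represented by the smaller element of an orbit of the involution `σ.glue k`,
so two edges end at it exactly if they have the same label and lie in one orbit. -/
theorem starGraph_tgt_eq_iff (i j : Fin 7) (k k' : Fin 3) :
    (σ.starGraph l hl).tgt (j, k') = (σ.starGraph l hl).tgt (i, k) ↔
      (j, k') = (i, k) ∨ (j, k') = (σ.glue k i, k) := by
  have h1 := σ.involutive k i
  simp only [starGraph, Sum.inr.injEq, Subtype.mk.injEq, Prod.mk.injEq]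
  constructor
  · rintro ⟨h, rfl⟩
    have h2 := σ.involutive k' j
    rcases min_choice j (σ.glue k' j) with h3 | h3 <;>
      rcases min_choice i (σ.glue k' i) with h4 | h4 <;> grind
  · rintro (⟨rfl, rfl⟩ | ⟨rfl, rfl⟩)
    · simp
    · rw [h1, min_comm]; simp

theorem starGraph_filter_tgt_eq (i : Fin 7) (k : Fin 3) :
    (Finset.univ.filter fun e => (σ.starGraph l hl).tgt e = (σ.starGraph l hl).tgt (i, k)) =
      {(i, k), (σ.glue k i, k)} := by
  ext ⟨j, k'⟩
  simp [starGraph_tgt_eq_iff]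

theorem starGraph_exists_tgt_eq (p : σ.OuterVertex) :
    (Sum.inr p : Fin 7 ⊕ σ.OuterVertex) = (σ.starGraph l hl).tgt p.1 := by
  obtain ⟨⟨i, k⟩, h⟩ := p
  simp [starGraph, min_eq_left h]

theorem starGraph_degree_inl (i : Fin 7) : (σ.starGraph l hl).degree (Sum.inl i) ≠ 1 := by
  have : (Finset.univ.filter fun e : Fin 7 × Fin 3 =>
      (σ.starGraph l hl).src e = Sum.inl i ∨ (σ.starGraph l hl).tgt e = Sum.inl i) =
      {i} ×ˢ Finset.univ := by
    ext ⟨j, k⟩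
    simp [starGraph, eq_comm]
  simp [degree, this]

theorem starGraph_degree_tgt (i : Fin 7) (k : Fin 3) :
    (σ.starGraph l hl).degree ((σ.starGraph l hl).tgt (i, k)) = 1 ↔ σ.glue k i = i := by
  have : (Finset.univ.filter fun e : Fin 7 × Fin 3 =>
      (σ.starGraph l hl).src e = (σ.starGraph l hl).tgt (i, k) ∨
        (σ.starGraph l hl).tgt e = (σ.starGraph l hl).tgt (i, k)) =
      {(i, k), (σ.glue k i, k)} := by
    rw [← starGraph_filter_tgt_eq σ l hl]
    refine Finset.filter_congr fun e _ => or_iff_right ?_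
    simp [starGraph]
  rw [degree, this]
  by_cases h : σ.glue k i = i
  · simp [h]
  · rw [Finset.card_pair (by simpa using Ne.symm h)]
    simp [h]

variable {σ l hl} {φ dφ : Fin 7 × Fin 3 → ℝ → ℂ}

/-- The boundary conditions on a star graph, where the conditions at the outer ends of the edges
are expressed by reflections. -/
theorem dirichletStandard_starGraph_iff :
    (σ.starGraph l hl).DirichletStandard φ dφ ↔
      (∃ c : Fin 7 → ℂ, ∀ i k, φ (i, k) 0 = c i) ∧ (∀ i, ∑ k, dφ (i, k) 0 = 0) ∧
      (∀ i k, φ (i, k) (l k) = σ.sign k i * φ (σ.glue k i, k) (l k)) ∧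
      ∀ i k, dφ (i, k) (l k) = -(σ.sign k i * dφ (σ.glue k i, k) (l k)) := by
  have hsrc : ∀ i, (Finset.univ.filter fun e : Fin 7 × Fin 3 =>
      (σ.starGraph l hl).src e = Sum.inl i) = {i} ×ˢ Finset.univ := fun i => by
    ext ⟨j, k⟩; simp [starGraph, eq_comm]
  have htgt : ∀ i, (Finset.univ.filter fun e : Fin 7 × Fin 3 =>
      (σ.starGraph l hl).tgt e = Sum.inl i) = ∅ := fun i => by
    ext ⟨j, k⟩; simp [starGraph]
  have hsrc' : ∀ e, (Finset.univ.filter fun e' : Fin 7 × Fin 3 =>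
      (σ.starGraph l hl).src e' = (σ.starGraph l hl).tgt e) = ∅ := fun e => by
    ext ⟨j, k⟩; simp [starGraph]
  constructor
  · rintro ⟨⟨val, hv, hd⟩, hk⟩
    refine ⟨⟨fun i => val (Sum.inl i), fun i k => (hv (i, k)).1⟩, fun i => ?_, fun i k => ?_,
      fun i k => ?_⟩
    · have := hk (Sum.inl i) (starGraph_degree_inl σ l hl i)
      rw [hsrc, htgt, Finset.sum_product] at this
      simpa using this
    · have h1 : φ (i, k) (l k) = val ((σ.starGraph l hl).tgt (i, k)) := (hv (i, k)).2
      by_cases h : σ.glue k i = i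
      · rw [hd _ ((starGraph_degree_tgt σ l hl i k).2 h)] at h1
        rw [h, h1, mul_zero]
      · have h2 : φ (σ.glue k i, k) (l k) = val ((σ.starGraph l hl).tgt (σ.glue k i, k)) :=
          (hv (σ.glue k i, k)).2
        rw [(starGraph_tgt_eq_iff σ l hl i (σ.glue k i) k k).2 (Or.inr rfl), ← h1] at h2
        simp [sign, h, h2]
    · by_cases h : σ.glue k i = i
      -- At a boundary side the sign is -1, and the derivative condition is void, as it must be at a
      -- Dirichlet vertex.
      · simp [sign, h]
      · have := hk _ ((starGraph_degree_tgt σ l hl i k).not.2 h)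
        rw [hsrc', starGraph_filter_tgt_eq, Finset.sum_pair (by simpa using Ne.symm h),
          Finset.sum_empty, add_zero] at this
        simp only [sign, h, if_false, Int.cast_one, one_mul]
        exact eq_neg_of_add_eq_zero_left this
  · rintro ⟨⟨c, hc⟩, hk, hφ, hdφ⟩
    refine ⟨⟨Sum.elim c fun p => φ p.1 (l p.1.2), fun e => ⟨hc e.1 e.2, ?_⟩, fun v hv => ?_⟩,
      fun v hv => ?_⟩
    · obtain ⟨i, k⟩ := e
      change φ (i, k) (l k) = φ (min i (σ.glue k i), k) (l k)
      rcases min_choice i (σ.glue k i) with h | h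
      · rw [h]
      · rw [h]
        by_cases h' : σ.glue k i = i
        · rw [h']
        · simpa [sign, h'] using hφ i k
    · rcases v with i | p
      · exact absurd hv (starGraph_degree_inl σ l hl i)
      · rw [starGraph_exists_tgt_eq σ l hl, starGraph_degree_tgt] at hv
        have := hφ p.1.1 p.1.2
        rw [hv] at this
        simp only [sign, hv, if_true, Int.cast_neg, Int.cast_one, neg_mul, one_mul] at this
        -- At a boundary side the reflection condition says that the value is its own negative.
        exact self_eq_neg.1 this
    · rcases v with i | p
      · rw [hsrc, htgt, Finset.sum_product]
        simpa using hk i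
      · rw [starGraph_exists_tgt_eq σ l hl] at hv ⊢
        obtain ⟨⟨i, k⟩, hp⟩ := p
        have h := (starGraph_degree_tgt σ l hl i k).not.1 hv
        rw [hsrc', starGraph_filter_tgt_eq, Finset.sum_pair (by simpa using Ne.symm h),
          Finset.sum_empty, add_zero]
        have := hdφ i k
        simp only [sign, h, if_false, Int.cast_one, one_mul] at this
        exact add_eq_zero_iff_eq_neg.2 this

variable (l hl) in
/-- A star graph is anchored if every star is glued to a star with a boundary side. -/
theorem starGraph_anchored (h : ∀ i, ∃ k k', σ.glue k (σ.glue k' i) = σ.glue k' i) :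
    (σ.starGraph l hl).Anchored := by
  intro val he hd
  have h1 : ∀ i k, val (Sum.inl i) = val ((σ.starGraph l hl).tgt (i, k)) := fun i k => he (i, k)
  have h2 : ∀ i, val (Sum.inl i) = 0 := fun i => by
    obtain ⟨k, k', hk⟩ := h i
    rw [h1 i k', ← (starGraph_tgt_eq_iff σ l hl i (σ.glue k' i) k' k').2 (Or.inr rfl), ← h1,
      h1 _ k]
    exact hd _ ((starGraph_degree_tgt σ l hl _ k).2 hk)
  ext v
  rcases v with i | p
  · exact h2 i
  · rw [starGraph_exists_tgt_eq σ l hl, ← Prod.mk.eta (p := p.1), ← h1]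
    exact h2 _

end Star

/-! ### Transplantation of eigenfunctions -/

section Transplantation

variable {l : Fin 3 → ℝ}

/-- Functions on one star graph are combined to functions on another star graph, with the same
edge lengths. -/
def transplant (l : Fin 3 → ℝ) (T : Matrix (Fin 7) (Fin 7) ℤ) :
    (PiLp 2 fun e : Fin 7 × Fin 3 => Lp ℂ 2 (volume.restrict (Icc 0 (l e.2)))) →ₗ[ℂ]
      PiLp 2 fun e : Fin 7 × Fin 3 => Lp ℂ 2 (volume.restrict (Icc 0 (l e.2))) where
  toFun f := WithLp.toLp 2 fun e => ∑ j, (T e.1 j : ℂ) • f (j, e.2)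
  map_add' f g := by
    ext e : 1
    simp [smul_add, Finset.sum_add_distrib]
  map_smul' c f := by
    ext e : 1
    simp [Finset.smul_sum, smul_comm c]

theorem transplant_apply (T : Matrix (Fin 7) (Fin 7) ℤ)
    (f : PiLp 2 fun e : Fin 7 × Fin 3 => Lp ℂ 2 (volume.restrict (Icc 0 (l e.2))))
    (i : Fin 7) (k : Fin 3) : transplant l T f (i, k) = ∑ j, (T i j : ℂ) • f (j, k) := rfl

theorem transplant_ae_eq (T : Matrix (Fin 7) (Fin 7) ℤ)
    {f : PiLp 2 fun e : Fin 7 × Fin 3 => Lp ℂ 2 (volume.restrict (Icc 0 (l e.2)))}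
    {φ : Fin 7 × Fin 3 → ℝ → ℂ} (h : ∀ e, f e =ᵐ[volume.restrict (Icc 0 (l e.2))] φ e)
    (e : Fin 7 × Fin 3) : transplant l T f e =ᵐ[volume.restrict (Icc 0 (l e.2))]
      fun x => ∑ j, (T e.1 j : ℂ) * φ (j, e.2) x := by
  obtain ⟨i, k⟩ := e
  rw [transplant_apply]
  have h1 : ∀ᵐ x ∂volume.restrict (Icc 0 (l k)), ∀ j, f (j, k) x = φ (j, k) x :=
    ae_all_iff.2 fun j => h (j, k)
  have h2 : ∀ᵐ x ∂volume.restrict (Icc 0 (l k)), ∀ j,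
      ((T i j : ℂ) • f (j, k) : Lp ℂ 2 (volume.restrict (Icc 0 (l k)))) x =
        (T i j : ℂ) * f (j, k) x :=
    ae_all_iff.2 fun j => Lp.coeFn_smul (T i j : ℂ) (f (j, k))
  filter_upwards [h1, h2, Lp.coeFn_finsetSum Finset.univ
    (fun j => (T i j : ℂ) • f (j, k))] with x h1 h2 h3
  rw [h3]
  simp only [Finset.sum_apply, h1, h2]

theorem transplant_transplant {T P : Matrix (Fin 7) (Fin 7) ℤ} {d : ℤ}
    (h : P * T = d • (1 : Matrix (Fin 7) (Fin 7) ℤ))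
    (f : PiLp 2 fun e : Fin 7 × Fin 3 => Lp ℂ 2 (volume.restrict (Icc 0 (l e.2)))) :
    transplant l P (transplant l T f) = (d : ℂ) • f := by
  ext ⟨i, k⟩ : 1
  simp only [transplant_apply, PiLp.smul_apply, Finset.smul_sum, smul_smul]
  rw [Finset.sum_comm]
  have h1 : ∀ j, ∑ m, ((P i m : ℂ) * T m j) = if i = j then (d : ℂ) else 0 := fun j => by
    have := congrFun (congrFun h i) j
    rw [Matrix.mul_apply, Matrix.smul_apply, Matrix.one_apply] at this
    have := congrArg (Int.cast : ℤ → ℂ) this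
    push_cast at this
    rw [this]
    split_ifs <;> simp
  simp_rw [← Finset.sum_smul, h1]
  simp

variable {σ τ : Gluing} {hl : ∀ k, 0 < l k} {T : Matrix (Fin 7) (Fin 7) ℤ}

/-- A matrix which intertwines the reflections of two gluings maps the domain of the Laplacian to
the domain of the Laplacian. -/
theorem isLaplacian_transplant
    (hT : ∀ k i j, σ.sign k j * T i (σ.glue k j) = τ.sign k i * T (τ.glue k i) j)
    {f g : (σ.starGraph l hl).L2} (h : (σ.starGraph l hl).IsLaplacian f g) :
    (τ.starGraph l hl).IsLaplacian (transplant l T f) (transplant l T g) := by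
  obtain ⟨φ, dφ, h⟩ := isLaplacian_iff_exists_isRep.1 h
  obtain ⟨⟨c, hc⟩, hk, hφ, hdφ⟩ := dirichletStandard_starGraph_iff.1 h.boundary
  -- The intertwining relation applied to a vector u: reflecting after the transplantation is the
  -- same as transplanting the reflected vector.
  have hsum : ∀ (k : Fin 3) (i : Fin 7) (u : Fin 7 → ℂ),
      ∑ j, (τ.sign k i : ℂ) * (T (τ.glue k i) j * u j) =
        ∑ j, (T i j : ℂ) * (σ.sign k j * u (σ.glue k j)) := fun k i u => by
    rw [← Equiv.sum_comp (σ.glue k) fun j => (T i j : ℂ) * (σ.sign k j * u (σ.glue k j))]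
    refine Finset.sum_congr rfl fun j _ => ?_
    have := congrArg (Int.cast : ℤ → ℂ) (hT k i j)
    push_cast at this
    rw [σ.involutive, sign_glue]
    linear_combination (-u j) * this
  refine isLaplacian_iff_exists_isRep.2 ⟨fun e x => ∑ j, (T e.1 j : ℂ) * φ (j, e.2) x,
    fun e x => ∑ j, (T e.1 j : ℂ) * dφ (j, e.2) x, transplant_ae_eq T h.ae_eq, fun e x hx => ?_,
    fun e x hx => ?_, dirichletStandard_starGraph_iff.2
      ⟨⟨fun i => ∑ j, (T i j : ℂ) * c j, fun i k => ?_⟩, fun i => ?_, fun i k => ?_,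
        fun i k => ?_⟩⟩
  · rw [intervalIntegral.integral_finsetSum fun j _ =>
      (intervalIntegrable_edge hx (h.integrableOn_deriv (j, e.2))).const_mul _,
      ← Finset.sum_add_distrib]
    refine Finset.sum_congr rfl fun j _ => ?_
    rw [intervalIntegral.integral_const_mul, h.primitive (j, e.2) x hx]
    ring
  · refine Eq.trans ?_ (congrArg (HAdd.hAdd _) ((τ.starGraph l hl).integral_congr_edge hx
      (transplant_ae_eq T (fun e => Filter.EventuallyEq.refl _ (g e)) e)).symm)
    rw [intervalIntegral.integral_finsetSum fun j _ =>
      (intervalIntegrable_edge hx (integrableOn_edge g (j, e.2))).const_mul _,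
      ← Finset.sum_add_distrib]
    refine Finset.sum_congr rfl fun j _ => ?_
    rw [intervalIntegral.integral_const_mul, h.deriv_primitive (j, e.2) x hx]
    ring
  · simp only [hc]
  · rw [Finset.sum_comm]
    simp only [← Finset.mul_sum, hk, mul_zero, Finset.sum_const_zero]
  · rw [Finset.mul_sum, hsum k i fun j => φ (j, k) (l k)]
    exact Finset.sum_congr rfl fun j _ => by rw [← hφ j k]
  · rw [Finset.mul_sum, hsum k i fun j => dφ (j, k) (l k), ← Finset.sum_neg_distrib]
    exact Finset.sum_congr rfl fun j _ => by rw [← mul_neg, ← hdφ j k]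

/-- Transplantation maps eigenspaces to eigenspaces, and the left inverse up to the factor d makes
it injective. Only inequality of ranks is needed, since the roles of the two graphs can be
exchanged. -/
theorem rank_eigenspace_le {P : Matrix (Fin 7) (Fin 7) ℤ} {d : ℤ} (hd : d ≠ 0)
    (hT : ∀ k i j, σ.sign k j * T i (σ.glue k j) = τ.sign k i * T (τ.glue k i) j)
    (hP : P * T = d • (1 : Matrix (Fin 7) (Fin 7) ℤ)) (μ : ℂ) :
    Module.rank ℂ ((σ.starGraph l hl).eigenspace μ) ≤
      Module.rank ℂ ((τ.starGraph l hl).eigenspace μ) := by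
  have hmem : ∀ f ∈ (σ.starGraph l hl).eigenspace μ,
      transplant l T f ∈ (τ.starGraph l hl).eigenspace μ := fun f hf => by
    have h1 := isLaplacian_transplant hT (show (σ.starGraph l hl).IsLaplacian f (-(μ • f)) from hf)
    have h2 : transplant l T (-(μ • f)) = -(μ • transplant l T f) :=
      ((transplant l T).map_neg _).trans (congrArg Neg.neg ((transplant l T).map_smul μ f))
    rw [h2] at h1
    exact h1
  refine LinearMap.rank_le_of_injective ((transplant l T).restrict hmem) ?_
  refine (injective_iff_map_eq_zero _).2 fun f hf => ?_
  have h1 : transplant l T f.1 = 0 := congrArg Subtype.val hf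
  have h2 := (transplant_transplant (l := l) hP f.1).symm
  rw [h1, map_zero] at h2
  exact Subtype.ext ((smul_eq_zero.1 h2).resolve_left (Int.cast_ne_zero.2 hd))

end Transplantation
end Gluing

/-! ### The linear system of the torsion function, over a commutative ring -/

section BranchedSystem

variable {K : Type*} [CommRing K]

/-- The determinant of the equations for the two stars of a branch, which is attached along a side
of inverse length `p`, while the two stars are glued along a side of inverse length `q`. -/
def branchDet (p q r : K) : K := (2 * p + q + 2 * r) * (p + q + 2 * r) - q ^ 2

/-- Right-hand side of the equation for the star in the center. -/
def weightCenter (p q r : K) : K := 2 * (q * r + p * r + p * q)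

/-- Right-hand side of the equation for the inner star of a branch. -/
def weightInner (p q r : K) : K := 2 * q * r + 2 * p * r + p * q

/-- Right-hand side of the equation for the outer star of a branch. -/
def weightOuter (p q r : K) : K := q * r + 2 * p * r + p * q

/-- The contribution of the right-hand sides of a branch to the value at its inner star. -/
def branchInner (p q r : K) : K :=
  (2 * p + q + 2 * r) * weightInner p q r + q * weightOuter p q r

/-- The contribution of the right-hand sides of a branch to the value at its outer star. -/
def branchOuter (p q r : K) : K :=
  q * weightInner p q r + (p + q + 2 * r) * weightOuter p q r

/-- The determinant of the equations for the values of the torsion function at the centers of the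
stars. -/
def torsionDet (p q r : K) : K :=
  (p + q + r) * branchDet p r q * branchDet q p r * branchDet r q p -
    p ^ 2 * (2 * p + r + 2 * q) * branchDet q p r * branchDet r q p -
    q ^ 2 * (2 * q + p + 2 * r) * branchDet p r q * branchDet r q p -
    r ^ 2 * (2 * r + q + 2 * p) * branchDet p r q * branchDet q p r

/-- The cofactor of a branch in `torsionDet`; the other two branches are `(q, p, r)` and
`(r, q, p)`. -/
def cofactor (p q r : K) : K :=
  (p + q + r) * branchDet q p r * branchDet r q p -
    q ^ 2 * (2 * q + p + 2 * r) * branchDet r q p - r ^ 2 * (2 * r + q + 2 * p) * branchDet q p r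

/-- The contribution of the center and the other two branches to the values on a branch. -/
def outsideWeight (p q r : K) : K :=
  weightCenter p q r * branchDet q p r * branchDet r q p +
    q * branchInner q p r * branchDet r q p + r * branchInner r q p * branchDet q p r

/-- The numerator of the value at the center, by Cramer's rule. -/
def numCenter (p q r : K) : K :=
  outsideWeight p q r * branchDet p r q +
    p * branchInner p r q * branchDet q p r * branchDet r q p

/-- The numerator of the value at an inner star, by Cramer's rule. -/
def numInner (p q r : K) : K :=
  branchInner p r q * cofactor p q r + p * (2 * p + r + 2 * q) * outsideWeight p q r

/-- The numerator of the value at an outer star, by Cramer's rule. -/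
def numOuter (p q r : K) : K :=
  branchOuter p r q * cofactor p q r - p ^ 2 * weightOuter p r q * branchDet q p r *
    branchDet r q p + p * r * outsideWeight p q r

/-- The numerator of the torsional rigidity. -/
def torsionNum (p q r : K) : K :=
  weightCenter p q r * numCenter p q r +
    (weightInner p r q * numInner p q r + weightOuter p r q * numOuter p q r) +
    (weightInner q p r * numInner q r p + weightOuter q p r * numOuter q r p) +
    (weightInner r q p * numInner r p q + weightOuter r q p * numOuter r p q)

/-- Cramer's rule for the equations for the values of the torsion function. -/
theorem torsionDet_mul_eq (p q r y0 y1 y2 y3 y4 y5 y6 : K)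
    (E0 : (p + q + r) * y0 - p * y3 - q * y5 - r * y1 = weightCenter p q r)
    (E3 : (p + r + 2 * q) * y3 - p * y0 - r * y4 = weightInner p r q)
    (E4 : (2 * p + r + 2 * q) * y4 - r * y3 = weightOuter p r q)
    (E5 : (q + p + 2 * r) * y5 - q * y0 - p * y6 = weightInner q p r)
    (E6 : (2 * q + p + 2 * r) * y6 - p * y5 = weightOuter q p r)
    (E1 : (r + q + 2 * p) * y1 - r * y0 - q * y2 = weightInner r q p)
    (E2 : (2 * r + q + 2 * p) * y2 - q * y1 = weightOuter r q p) :
    torsionDet p q r * (weightCenter p q r * y0 +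
      (weightInner p r q * y3 + weightOuter p r q * y4) +
      (weightInner q p r * y5 + weightOuter q p r * y6) +
      (weightInner r q p * y1 + weightOuter r q p * y2)) = torsionNum p q r := by
  -- The coefficient matrix is symmetric, so combining the equations with the Cramer numerators as
  -- coefficients yields the determinant times the weighted sum of the y's. No division or
  -- invertibility of the determinant is needed.
  have h := congrArg₂ (· + ·) (congrArg (numCenter p q r * ·) E0) <|
    congrArg₂ (· + ·) (congrArg₂ (· + ·) (congrArg (numInner p q r * ·) E3)
      (congrArg (numOuter p q r * ·) E4)) <|
    congrArg₂ (· + ·) (congrArg₂ (· + ·) (congrArg (numInner q r p * ·) E5)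
      (congrArg (numOuter q r p * ·) E6)) (congrArg₂ (· + ·) (congrArg (numInner r p q * ·) E1)
      (congrArg (numOuter r p q * ·) E2))
  simp only [torsionNum]
  simp only [torsionDet, weightCenter, weightInner, weightOuter, numCenter, numInner, numOuter,
    cofactor, outsideWeight, branchInner, branchOuter, branchDet] at h ⊢
  linear_combination h

/-- With B_k the signed permutation of the label k, the coefficient matrix is the sum over k of (1 -
B_k) divided by the length of k. The transplantation conjugates the matrices of the two gluings into
each other, so the determinants had to agree. The right-hand sides carry no such symmetry. -/
theorem torsionDet_swap (p q r : K) : torsionDet p r q = torsionDet p q r := by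
  simp only [torsionDet, branchDet]
  ring

/-- The torsional rigidities of the two domains differ. -/
theorem torsionNum_sub_swap (p q r : K) :
    torsionNum p r q - torsionNum p q r = 4 * ((p - q) * (q - r) * (r - p)) *
      (44 * p ^ 5 * q ^ 2 + 92 * p ^ 5 * q * r + 44 * p ^ 5 * r ^ 2 + 132 * p ^ 4 * q ^ 3 + 508 * p ^ 4 * q ^ 2 * r
        + 508 * p ^ 4 * q * r ^ 2 + 132 * p ^ 4 * r ^ 3 + 132 * p ^ 3 * q ^ 4 + 832 * p ^ 3 * q ^ 3 * r +
        1452 * p ^ 3 * q ^ 2 * r ^ 2 + 832 * p ^ 3 * q * r ^ 3 + 132 * p ^ 3 * r ^ 4 + 44 * p ^ 2 * q ^ 5 +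
        508 * p ^ 2 * q ^ 4 * r + 1452 * p ^ 2 * q ^ 3 * r ^ 2 + 1452 * p ^ 2 * q ^ 2 * r ^ 3 + 508 * p ^ 2
        * q * r ^ 4 + 44 * p ^ 2 * r ^ 5 + 92 * p * q ^ 5 * r + 508 * p * q ^ 4 * r ^ 2 + 832 * p *
        q ^ 3 * r ^ 3 + 508 * p * q ^ 2 * r ^ 4 + 92 * p * q * r ^ 5 + 44 * q ^ 5 * r ^ 2 + 132 * q ^ 4 *
        r ^ 3 + 132 * q ^ 3 * r ^ 4 + 44 * q ^ 2 * r ^ 5) := by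
  simp only [torsionNum, weightCenter, weightInner, weightOuter, numCenter, numInner, numOuter,
    cofactor, outsideWeight, branchInner, branchOuter, branchDet]
  ring

end BranchedSystem

/-! ### The torsional rigidities of the two graphs -/

namespace Gluing

open MetricGraph

section Torsion

variable {σ : Gluing} {l : Fin 3 → ℝ} {hl : ∀ k, 0 < l k}

/-- The equations for the values at the centers of the stars of the solution of `Δ u = 1`, and the
integral of this solution. -/
theorem exists_torsion_equations (hG : (σ.starGraph l hl).Anchored) :
    ∃ c : Fin 7 → ℂ,
      (∀ i, ∑ k, (if σ.glue k i = i then 2 * ((l k : ℂ)⁻¹ * c i) + l k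
        else (l k : ℂ)⁻¹ * (c i - c (σ.glue k i)) + 2 * l k) = 0) ∧
      inner ℂ (σ.starGraph l hl).one (hG.inverse (σ.starGraph l hl).one) =
        ∑ i, ∑ k, (if σ.glue k i = i then l k * c i / 2 - (l k : ℂ) ^ 3 / 12
          else l k * (3 * c i + c (σ.glue k i)) / 4 - (l k : ℂ) ^ 3 / 3) := by
  obtain ⟨φ, dφ, h⟩ := isLaplacian_iff_exists_isRep.1
    (hG.isLaplacian_inverse (σ.starGraph l hl).one)
  obtain ⟨⟨c, hc⟩, hk, hφ, hdφ⟩ := dirichletStandard_starGraph_iff.1 h.boundary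
  have hl0 : ∀ k, (l k : ℂ) ≠ 0 := fun k => Complex.ofReal_ne_zero.2 (hl k).ne'
  have hd : ∀ i k, ∀ x ∈ Icc 0 (l k), dφ (i, k) x = dφ (i, k) 0 + x := fun i k x hx => by
    refine (h.deriv_primitive (i, k) x hx).trans (congrArg (HAdd.hAdd _) ?_)
    rw [(σ.starGraph l hl).integral_congr_edge hx (one_ae_eq _ (i, k))]
    simp
  have hv : ∀ i k, ∀ x ∈ Icc 0 (l k), φ (i, k) x = c i + dφ (i, k) 0 * x + (x : ℂ) ^ 2 / 2 :=
    fun i k x hx => by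
      rw [h.primitive (i, k) x hx, hc, add_assoc]
      congr 1
      have : ∫ s in (0 : ℝ)..x, dφ (i, k) s = ∫ s in (0 : ℝ)..x, (dφ (i, k) 0 + (s : ℂ)) := by
        refine intervalIntegral.integral_congr fun s hs => hd i k s ?_
        rw [uIcc_of_le hx.1] at hs
        exact ⟨hs.1, hs.2.trans hx.2⟩
      rw [this, intervalIntegral.integral_add (by simp)
        (Complex.continuous_ofReal.intervalIntegrable _ _), intervalIntegral.integral_ofReal,
        integral_id]
      simp [mul_comm]
  have hr : ∀ k, l k ∈ Icc 0 (l k) := fun k => right_mem_Icc.2 (hl k).le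
  -- The initial slope from the condition at the outer end: on a boundary side the value there is
  -- zero; on an interior side the values agree and the slopes are opposite.
  have hβ : ∀ i k, dφ (i, k) 0 = if σ.glue k i = i then -((l k : ℂ)⁻¹ * c i) - l k / 2
      else (l k : ℂ)⁻¹ * (c (σ.glue k i) - c i) / 2 - l k := fun i k => by
    have h1 := hφ i k
    have h2 := hdφ i k
    rw [hv _ k _ (hr k), hv _ k _ (hr k)] at h1
    rw [hd _ k _ (hr k), hd _ k _ (hr k)] at h2
    have h0 := hl0 k
    by_cases hi : σ.glue k i = i
    · simp only [sign, hi, if_true, Int.cast_neg, Int.cast_one] at h1 ⊢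
      field_simp
      linear_combination h1
    · simp only [sign, hi, if_false, Int.cast_one, one_mul] at h1 h2 ⊢
      field_simp
      linear_combination h1 + (l k : ℂ) * h2
  refine ⟨c, fun i => ?_, ?_⟩
  · have h1 := congrArg (-2 * ·) (hk i)
    simp only [hβ, Finset.mul_sum, mul_zero] at h1
    rw [← h1]
    refine Finset.sum_congr rfl fun k _ => ?_
    split_ifs <;> ring
  · rw [inner_one, Fintype.sum_prod_type]
    refine Finset.sum_congr rfl fun i _ => Finset.sum_congr rfl fun k _ => ?_
    have h1 : ∫ x in Icc 0 (l k), φ (i, k) x =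
        l k * c i + dφ (i, k) 0 * (l k : ℂ) ^ 2 / 2 + (l k : ℂ) ^ 3 / 6 := by
      rw [setIntegral_congr_fun measurableSet_Icc (hv i k), integral_Icc_eq_integral_Ioc,
        ← intervalIntegral.integral_of_le (hl k).le, intervalIntegral.integral_add
        (Continuous.intervalIntegrable (by fun_prop) _ _)
        (Continuous.intervalIntegrable (by fun_prop) _ _), intervalIntegral.integral_add
        (Continuous.intervalIntegrable (by fun_prop) _ _)
        (Continuous.intervalIntegrable (by fun_prop) _ _), intervalIntegral.integral_const_mul,
        intervalIntegral.integral_div, intervalIntegral.integral_ofReal, integral_id]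
      have : ∫ x in (0 : ℝ)..l k, (x : ℂ) ^ 2 = (l k : ℂ) ^ 3 / 3 := by
        have := intervalIntegral.integral_ofReal (a := 0) (b := l k) (μ := volume)
          (f := fun x => x ^ 2)
        push_cast at this
        rw [this, integral_pow]
        push_cast
        norm_num
      rw [this]
      simp
      ring
    refine (integral_congr_ae (h.ae_eq (i, k))).trans (h1.trans ?_)
    have h0 := hl0 k
    rw [hβ]
    split_ifs <;> field_simp <;> ring

end Torsion

/-- The substitution y_i = -(pqr) x_i clears denominators and brings the system into the form of
`torsionDet_mul_eq`. The weights on its right-hand side reappear as the coefficients of the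
integral, so the rigidity is, up to normalisation, the weighted sum there. Each label has four edge
copies at interior sides and three at boundary sides, whence the constant 4/3 + 3/12 = 19/12. -/
theorem torsion_identity {w : Fin 3 → ℂ} {τ : ℂ} (hw : ∀ k, w k ≠ 0) (x : Fin 7 → ℂ)
    (E : ∀ i, ∑ k, (if sevenOneFirst.glue k i = i then 2 * ((w k)⁻¹ * x i) + w k
        else (w k)⁻¹ * (x i - x (sevenOneFirst.glue k i)) + 2 * w k) = 0)
    (hτ : τ = ∑ i, ∑ k, (if sevenOneFirst.glue k i = i then w k * x i / 2 - w k ^ 3 / 12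
        else w k * (3 * x i + x (sevenOneFirst.glue k i)) / 4 - w k ^ 3 / 3)) :
    torsionDet (w 0)⁻¹ (w 1)⁻¹ (w 2)⁻¹ * (-2 * ((w 0)⁻¹ * (w 1)⁻¹ * (w 2)⁻¹) ^ 2 *
      (τ + 19 / 12 * (w 0 ^ 3 + w 1 ^ 3 + w 2 ^ 3))) = torsionNum (w 0)⁻¹ (w 1)⁻¹ (w 2)⁻¹ := by
  have hg : ∀ k i, sevenOneFirst.glue k i =
      ![![3, 1, 2, 0, 4, 6, 5], ![5, 2, 1, 3, 4, 0, 6], ![1, 0, 2, 4, 3, 5, 6]] k i := by decide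
  simp only [hg] at E hτ
  have E0 := E 0
  have E1 := E 1
  have E2 := E 2
  have E3 := E 3
  have E4 := E 4
  have E5 := E 5
  have E6 := E 6
  clear E hg
  simp [Fin.sum_univ_succ] at E0 E1 E2 E3 E4 E5 E6 hτ
  have hp : w 0 * (w 0)⁻¹ = 1 := mul_inv_cancel₀ (hw 0)
  have hq : w 1 * (w 1)⁻¹ = 1 := mul_inv_cancel₀ (hw 1)
  have hr : w 2 * (w 2)⁻¹ = 1 := mul_inv_cancel₀ (hw 2)
  generalize (w 0)⁻¹ = p at *
  generalize (w 1)⁻¹ = q at *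
  generalize (w 2)⁻¹ = r at *
  have h := torsionDet_mul_eq p q r (-(p * q * r) * x 0) (-(p * q * r) * x 1)
    (-(p * q * r) * x 2) (-(p * q * r) * x 3) (-(p * q * r) * x 4) (-(p * q * r) * x 5)
    (-(p * q * r) * x 6)
    (by simp only [weightCenter]
        linear_combination -(p * q * r) * E0 + 2 * q * r * hp + 2 * p * r * hq + 2 * p * q * hr)
    (by simp only [weightInner]
        linear_combination -(p * q * r) * E3 + 2 * q * r * hp + p * r * hq + 2 * p * q * hr)
    (by simp only [weightOuter]
        linear_combination -(p * q * r) * E4 + q * r * hp + p * r * hq + 2 * p * q * hr)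
    (by simp only [weightInner]
        linear_combination -(p * q * r) * E5 + 2 * q * r * hp + 2 * p * r * hq + p * q * hr)
    (by simp only [weightOuter]
        linear_combination -(p * q * r) * E6 + 2 * q * r * hp + p * r * hq + p * q * hr)
    (by simp only [weightInner]
        linear_combination -(p * q * r) * E1 + q * r * hp + 2 * p * r * hq + 2 * p * q * hr)
    (by simp only [weightOuter]
        linear_combination -(p * q * r) * E2 + q * r * hp + 2 * p * r * hq + p * q * hr)
  rw [← h]
  congr 1
  rw [hτ]
  simp only [weightCenter, weightInner, weightOuter]
  linear_combination
    -(p * q * r) * (q * r) * (2 * (x 0 + x 3 + x 5 + x 6) + (x 1 + x 2 + x 4)) * hp -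
      (p * q * r) * (p * r) * (2 * (x 0 + x 1 + x 2 + x 5) + (x 3 + x 4 + x 6)) * hq -
      (p * q * r) * (p * q) * (2 * (x 0 + x 1 + x 3 + x 4) + (x 2 + x 5 + x 6)) * hr

/-- The torsional rigidities of the two star graphs differ. -/
theorem inner_inverse_one_ne {l : Fin 3 → ℝ} {hl : ∀ k, 0 < l k} (hinj : Function.Injective l)
    (h₁ : (sevenOneFirst.starGraph l hl).Anchored) (h₂ : (sevenOneSecond.starGraph l hl).Anchored) :
    inner ℂ (sevenOneFirst.starGraph l hl).one (h₁.inverse (sevenOneFirst.starGraph l hl).one) ≠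
      inner ℂ (sevenOneSecond.starGraph l hl).one
        (h₂.inverse (sevenOneSecond.starGraph l hl).one) := by
  intro heq
  obtain ⟨x, hx, hτ⟩ := exists_torsion_equations h₁
  obtain ⟨y, hy, hτ'⟩ := exists_torsion_equations h₂
  have hl0 : ∀ k, (l k : ℂ) ≠ 0 := fun k => Complex.ofReal_ne_zero.2 (hl k).ne'
  have e1 : ∀ k i, sevenOneFirst.glue (Equiv.swap 1 2 k) i = sevenOneSecond.glue k i := by decide
  have e2 : ∀ k : Fin 3, Equiv.swap 1 2 (Equiv.swap 1 2 k) = k := by decide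
  have h3 := torsion_identity hl0 x hx hτ
  -- The second gluing is the first after exchanging the labels 1 and 2, so the same identity holds
  -- with the two lengths exchanged. The correction by 19/12 times the cubes is invariant under
  -- this.
  have h4 := torsion_identity (fun k => hl0 (Equiv.swap 1 2 k)) y
    (fun i => (Equiv.sum_comp (Equiv.swap 1 2) _).symm.trans
      (by simpa only [e1, e2] using hy i))
    (hτ'.trans (Finset.sum_congr rfl fun i _ =>
      Eq.trans (by simp only [e1, e2]) (Equiv.sum_comp (Equiv.swap 1 2) _)))
  simp only [Equiv.swap_apply_left, Equiv.swap_apply_right,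
    show Equiv.swap (1 : Fin 3) 2 0 = 0 by decide] at h4
  rw [← heq, torsionDet_swap] at h4
  have h5 : torsionNum (l 0 : ℂ)⁻¹ (l 2 : ℂ)⁻¹ (l 1 : ℂ)⁻¹ -
      torsionNum (l 0 : ℂ)⁻¹ (l 1 : ℂ)⁻¹ (l 2 : ℂ)⁻¹ = 0 := by
    rw [← h3, ← h4]
    ring
  rw [torsionNum_sub_swap] at h5
  have hne : ∀ i j, i ≠ j → (l i)⁻¹ - (l j)⁻¹ ≠ 0 := fun i j hij =>
    sub_ne_zero.2 fun h => hij (hinj (inv_injective h))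
  have hp : ∀ k, 0 < (l k)⁻¹ := fun k => inv_pos.2 (hl k)
  have n01 := hne 0 1 (by decide)
  have n12 := hne 1 2 (by decide)
  have n20 := hne 2 0 (by decide)
  have p0 := hp 0
  have p1 := hp 1
  have p2 := hp 2
  simp only [← Complex.ofReal_inv] at h5
  generalize (l 0)⁻¹ = p at *
  generalize (l 1)⁻¹ = q at *
  generalize (l 2)⁻¹ = r at *
  norm_cast at h5
  -- Distinct lengths make the three differences nonzero; the remaining factor has positive
  -- coefficients and positive arguments.
  refine mul_ne_zero (mul_ne_zero four_ne_zero (mul_ne_zero (mul_ne_zero n01 n12) n20)) ?_ h5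
  positivity

/-! ### The transplantation matrices of the pair, and the conclusion -/

/-- The transplantation from the first to the second domain of the `7₁` pair. -/
def transplantation : Matrix (Fin 7) (Fin 7) ℤ :=
  !![0, -1, 0, -1, 0, -1, 0;
    -1, 0, -1, 1, 0, 0, 0;
    0, -1, 1, 0, 1, 0, 0;
    -1, 1, 0, 0, 0, 0, -1;
    0, 0, 1, 0, 0, -1, 1;
    -1, 0, 0, 0, -1, 1, 0;
    0, 0, 0, -1, 1, 0, 1]

/-- Six times the inverse of `transplantation`. -/
def transplantationInverse : Matrix (Fin 7) (Fin 7) ℤ :=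
  !![-1, -2, -1, -2, -1, -2, -1;
    -2, -1, -2, 2, 1, -1, 1;
    -1, -2, 2, 1, 2, 1, -1;
    -2, 2, 1, -1, 1, -1, -2;
    -1, 1, 2, 1, -1, -2, 2;
    -2, -1, 1, -1, -2, 2, 1;
    -1, 1, -1, -2, 2, 1, 2]

theorem isospectral_sevenOne (l : Fin 3 → ℝ) (hl : ∀ k, 0 < l k) :
    (sevenOneFirst.starGraph l hl).Isospectral (sevenOneSecond.starGraph l hl) := fun μ =>
  le_antisymm
    (rank_eigenspace_le (T := transplantation) (P := transplantationInverse) (d := 6) (by decide)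
      (by decide +kernel) (by decide +kernel) μ)
    (rank_eigenspace_le (T := transplantationInverse) (P := transplantation) (d := 6) (by decide)
      (by decide +kernel) (by decide +kernel) μ)

end Gluing

theorem mainTheorem4 (l : Fin 3 → ℝ) (hl : ∀ k, 0 < l k) (hdistinct : Function.Injective l) :
    (Gluing.sevenOneFirst.starGraph l hl).Isospectral (Gluing.sevenOneSecond.starGraph l hl) ∧
    Nonempty (Gluing.sevenOneFirst.starGraph l hl).SpectralResolution ∧
    Nonempty (Gluing.sevenOneSecond.starGraph l hl).SpectralResolution ∧
    ∀ (S₁ : (Gluing.sevenOneFirst.starGraph l hl).SpectralResolution)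
      (S₂ : (Gluing.sevenOneSecond.starGraph l hl).SpectralResolution),
      ∃ t : ℝ, 0 < t ∧ S₁.heatContent t ≠ S₂.heatContent t := by
  -- Star 0 has no boundary side, but its neighbours do, which is why the criterion allows one step
  -- to an adjacent star.
  have h₁ := Gluing.starGraph_anchored (σ := Gluing.sevenOneFirst) l hl (by decide)
  have h₂ := Gluing.starGraph_anchored (σ := Gluing.sevenOneSecond) l hl (by decide)
  refine ⟨Gluing.isospectral_sevenOne l hl, h₁.nonempty_spectralResolution,
    h₂.nonempty_spectralResolution, fun S₁ S₂ => ?_⟩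
  -- Equality for all t > 0 gives equal integrals over (0, ∞), hence equal torsional rigidities.
  by_contra! h
  refine Gluing.inner_inverse_one_ne hdistinct h₁ h₂ (neg_injective ?_)
  rw [← S₁.integral_heatContent h₁, ← S₂.integral_heatContent h₂]
  exact setIntegral_congr_fun measurableSet_Ioi h

end
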